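/- Let $\varepsilon_0,\mu_0>0$, let $\Omega\subset\mathbb R^3$ be open, and let $\varepsilon:\mathbb R^3\to\mathbb R$ be measurable with $0<\varepsilon_{\min}\le\varepsilon(x)\le\varepsilon_{\max}<\infty$ for almost every $x$, such that $\varepsilon-\varepsilon_0$ vanishes almost everywhere outside a compact subset of $\Omega$. Let $\sigma>0$ and $m\in\mathbb R$. For a complex Hilbert space $X$, let $H^m_\sigma(\mathbb R,X)$ be the space of distributions $f\in\mathcal D'(\mathbb R,X)$ such that $e^{-\sigma t}f$ is tempered and the Fourier–Laplace transform $\mathscr L[f](\omega)=\int_{\mathbb R}e^{i\omega t}f(t)\,dt$ on the line $\operatorname{Im}\omega=\sigma$ is a function with $$\|f\|_{H^m_\sigma(\mathbb R,X)}=\Big(\int_{-\infty+i\sigma}^{+\infty+i\sigma}|\omega|^{2m}\,\|\mathscr L[f](\omega)\|_X^2\,d\omega\Big)^{1/2}<\infty .$$ Call $f\in\mathcal D'(\mathbb R,X)$ causal if it vanishes on $(-\infty,0)$. Let $H(\mathrm{curl},\mathbb R^3)$ be the space of $u\in(L^2(\mathbb R^3))^3$ with $\nabla\times u\in(L^2(\mathbb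 R^3))^3$, with norm $(\|u\|_{L^2}^2+\|\nabla\times u\|_{L^2}^2)^{1/2}$. All fields are complex valued. An incident field is a causal $\mathcal E^i\in\mathcal D'(\mathbb R,(L^2(\Omega))^3)$ whose sources lie outside $\Omega$, that is, which satisfies the vacuum Maxwell equation $\nabla\times\nabla\times\mathcal E^i+\varepsilon_0\mu_0\,\partial_t^2\mathcal E^i=0$ in the sense of distributions in $\Omega\times\mathbb R$. **Theorem.** There is a constant $C>0$, depending only on $\Omega,\varepsilon,\varepsilon_0,\mu_0,\sigma,m$, such that for every incident field $\mathcal E^i\in H^m_\sigma(\mathbb R,(L^2(\Omega))^3)$ the scattering system $$\nabla\times\mathcal E^s+\mu_0\,\partial_t\mathcal H^s=0,\qquad \nabla\times\mathcal H^s-\varepsilon\,\partial_t\mathcal E^s=(\varepsilon-\varepsilon_0)\,\partial_t\mathcal E^i\qquad\text{in }\mathbb R^3\times\mathbb R$$ (in the sense of distributions, the right-hand side being $0$ outside $\Omega$), with zero initial data at $t=0$ in the sense that $\mathcal E^s$ and $\mathcal H^s$ are causal, has exactly one solution $(\mathcal E^s,\mathcal H^s)$ with $\mathcal E^s\in H^{m-1}_\sigma(\mathbb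 R,H(\mathrm{curl},\mathbb R^3))$ and $\mathcal H^s\in\mathcal D'(\mathbb R,(L^2(\mathbb R^3))^3)$. Moreover $$\|\mathcal E^s\|_{H^{m-1}_\sigma(\mathbb R,H(\mathrm{curl},\mathbb R^3))}\le C\,\|\mathcal E^i\|_{H^m_\sigma(\mathbb R,(L^2(\Omega))^3)} .$$ -/

import Mathlib

open MeasureTheory TopologicalSpace
open scoped Distributions SchwartzMap LineDeriv FourierTransform ENNReal NNReal ContDiff

/-! ### Vector fields on `ℝ³` and the space `H(curl, ℝ³)` -/

/-- Physical space `ℝ³`. -/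
abbrev R3 : Type := EuclideanSpace ℝ (Fin 3)

/-- The space `ℂ³` of values of the fields. -/
abbrev C3 : Type := EuclideanSpace ℂ (Fin 3)

/-- The space `(L²(Ω))³`. -/
abbrev L2On (Ω : Opens R3) : Type := Lp C3 2 ((volume : Measure R3).restrict (Ω : Set R3))

/-- The space `(L²(ℝ³))³`. -/
abbrev L2R3 : Type := Lp C3 2 (volume : Measure R3)

/-- The bilinear dot product on `ℂ³` (without complex conjugation). -/
def dot3 (a b : C3) : ℂ := ∑ i, a i * b i

/-- The partial derivative `∂ᵢ ψⱼ` at the point `x`. -/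
noncomputable def pd (i j : Fin 3) (ψ : R3 → C3) (x : R3) : ℂ :=
  (fderiv ℝ ψ x (EuclideanSpace.single i (1 : ℝ))) j

/-- The classical curl `∇ × ψ` of a differentiable vector field. -/
noncomputable def curl (ψ : R3 → C3) (x : R3) : C3 :=
  !₂[pd 1 2 ψ x - pd 2 1 ψ x, pd 2 0 ψ x - pd 0 2 ψ x, pd 0 1 ψ x - pd 1 0 ψ x]

/-- `∇ × u = w` in the sense of distributions on the open set `U`: the integrals run over
the support of the test field, which lies in `U`. -/
def IsWeakCurl (U : Opens R3) (u w : R3 → C3) : Prop :=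
  ∀ ψ : 𝓓(U, C3), ∫ x, dot3 (u x) (curl ψ x) = ∫ x, dot3 (w x) (ψ x)

theorem continuous_curl {ψ : R3 → C3} (h : ContDiff ℝ 1 ψ) : Continuous (curl ψ) := by
  have h1 : ∀ i j, Continuous (pd i j ψ) := fun i j => by
    have := h.continuous_fderiv one_ne_zero
    unfold pd
    fun_prop
  refine (PiLp.continuous_toLp 2 _).comp (continuous_pi fun i => ?_)
  fin_cases i
  · exact (h1 1 2).sub (h1 2 1)
  · exact (h1 2 0).sub (h1 0 2)
  · exact (h1 0 1).sub (h1 1 0)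

theorem hasCompactSupport_curl {ψ : R3 → C3} (h : HasCompactSupport ψ) :
    HasCompactSupport (curl ψ) := by
  refine (h.fderiv (𝕜 := ℝ)).mono fun x hx => ?_
  contrapose! hx
  have hx' : fderiv ℝ ψ x = 0 := by simpa using hx
  have : curl ψ x = 0 := by
    ext i
    fin_cases i <;> simp [curl, pd, hx']
  simpa using this

theorem integrable_dot3 (u : L2R3) {φ : R3 → C3} (hc : Continuous φ) (hs : HasCompactSupport φ) :
    Integrable (fun x => dot3 (u x) (φ x)) := by
  unfold dot3
  refine integrable_finsetSum _ fun i _ => ?_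
  have h1 : MemLp (fun x => (u x) i) 2 (volume : Measure R3) :=
    (EuclideanSpace.proj (𝕜 := ℂ) i : C3 →L[ℂ] ℂ).comp_memLp' (Lp.memLp u)
  have h2 : MemLp (fun x => (φ x) i) 2 (volume : Measure R3) :=
    (EuclideanSpace.proj (𝕜 := ℂ) i : C3 →L[ℂ] ℂ).comp_memLp' (hc.memLp_of_hasCompactSupport hs)
  exact h1.integrable_mul h2

theorem integral_dot3_add (u v : L2R3) {φ : R3 → C3} (hc : Continuous φ)
    (hs : HasCompactSupport φ) :
    ∫ x, dot3 ((u + v : L2R3) x) (φ x) = (∫ x, dot3 (u x) (φ x)) + ∫ x, dot3 (v x) (φ x) := by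
  rw [← integral_add (integrable_dot3 u hc hs) (integrable_dot3 v hc hs)]
  refine integral_congr_ae ?_
  filter_upwards [Lp.coeFn_add u v] with x hx
  rw [hx]
  simp only [dot3, Pi.add_apply, PiLp.add_apply, add_mul, Finset.sum_add_distrib]

theorem integral_dot3_smul (c : ℂ) (u : L2R3) (φ : R3 → C3) :
    ∫ x, dot3 ((c • u : L2R3) x) (φ x) = c * ∫ x, dot3 (u x) (φ x) := by
  rw [← integral_const_mul]
  refine integral_congr_ae ?_
  filter_upwards [Lp.coeFn_smul c u] with x hx
  rw [hx]
  simp only [dot3, Pi.smul_apply, PiLp.smul_apply, smul_eq_mul, Finset.mul_sum, mul_assoc]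

theorem continuous_integral_dot3 {φ : R3 → C3} (hc : Continuous φ) (hs : HasCompactSupport φ) :
    Continuous fun u : L2R3 => ∫ x, dot3 (u x) (φ x) := by
  let ψ : R3 → C3 := fun x => WithLp.toLp 2 fun i => star (φ x i)
  have hψc : Continuous ψ := by
    refine (PiLp.continuous_toLp 2 _).comp (continuous_pi fun i => ?_)
    fun_prop
  have hψs : HasCompactSupport ψ := hs.mono fun x hx => by
    contrapose! hx
    have h0 : φ x = 0 := by simpa using hx
    have : ψ x = 0 := by
      ext i
      simp [ψ, h0]
    simpa using this
  have hψ : MemLp ψ 2 (volume : Measure R3) := hψc.memLp_of_hasCompactSupport hψs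
  have key : (fun u : L2R3 => ∫ x, dot3 (u x) (φ x)) = fun u => inner ℂ (hψ.toLp ψ) u := by
    funext u
    rw [L2.inner_def]
    refine integral_congr_ae ?_
    filter_upwards [hψ.coeFn_toLp] with x hx
    rw [hx]
    simp [dot3, ψ, PiLp.inner_apply]
  rw [key]
  fun_prop

/-- The space `H(curl, ℝ³)`, realized as the space of pairs `(u, ∇ × u)` with both entries in
`(L²(ℝ³))³`; the norm is the graph norm `(‖u‖² + ‖∇ × u‖²)^(1/2)`. -/
noncomputable def HCurl : Submodule ℂ (WithLp 2 (L2R3 × L2R3)) where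
  carrier := {p | IsWeakCurl ⊤ p.fst p.snd}
  zero_mem' := by
    intro ψ
    have h : ∀ φ : R3 → C3, ∫ x, dot3 ((0 : L2R3) x) (φ x) = 0 := fun φ => by
      simpa using integral_dot3_smul 0 0 φ
    exact (h _).trans (h _).symm
  add_mem' := by
    intro p q hp hq ψ
    have hψ : ContDiff ℝ 1 ψ := ψ.contDiff.of_le (by exact_mod_cast le_top)
    have hs := ψ.hasCompactSupport
    simp only [WithLp.add_fst, WithLp.add_snd]
    rw [integral_dot3_add _ _ (continuous_curl hψ) (hasCompactSupport_curl hs),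
      integral_dot3_add _ _ ψ.continuous hs, hp ψ, hq ψ]
  smul_mem' := by
    intro c p hp ψ
    simp only [WithLp.smul_fst, WithLp.smul_snd]
    rw [integral_dot3_smul, integral_dot3_smul, hp ψ]

theorem isClosed_HCurl : IsClosed (HCurl : Set (WithLp 2 (L2R3 × L2R3))) := by
  have h : (HCurl : Set (WithLp 2 (L2R3 × L2R3))) = ⋂ ψ : 𝓓((⊤ : Opens R3), C3),
      {p | ∫ x, dot3 (p.fst x) (curl ψ x) = ∫ x, dot3 (p.snd x) (ψ x)} := by
    ext p
    simp only [Set.mem_iInter]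
    exact Iff.rfl
  rw [h]
  refine isClosed_iInter fun ψ => ?_
  have hψ : ContDiff ℝ 1 ψ := ψ.contDiff.of_le (by exact_mod_cast le_top)
  have hs := ψ.hasCompactSupport
  exact isClosed_eq
    ((continuous_integral_dot3 (continuous_curl hψ) (hasCompactSupport_curl hs)).comp
      (WithLp.prod_continuous_ofLp 2 L2R3 L2R3).fst)
    ((continuous_integral_dot3 ψ.continuous hs).comp
      (WithLp.prod_continuous_ofLp 2 L2R3 L2R3).snd)

instance : CompleteSpace HCurl := isClosed_HCurl.completeSpace_coe

/-- The underlying `L²` field of an element of `H(curl, ℝ³)`. -/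
noncomputable def HCurl.field (u : HCurl) : L2R3 := (u : WithLp 2 (L2R3 × L2R3)).fst

/-- The curl `∇ × u` of an element `u` of `H(curl, ℝ³)`. -/
noncomputable def HCurl.curl (u : HCurl) : L2R3 := (u : WithLp 2 (L2R3 × L2R3)).snd

/-! ### Fourier-Laplace transform and the spaces `H_σ^m(ℝ, X)` -/

section Laplace

variable {X : Type*} [NormedAddCommGroup X] [NormedSpace ℂ X]

/-- The test function `t ↦ e^{-σ t} φ(t)`, for `φ` a test function on the line. -/
noncomputable def expMul (σ : ℝ) (φ : 𝓓((⊤ : Opens ℝ), ℝ)) : 𝓓((⊤ : Opens ℝ), ℝ) where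
  toFun t := Real.exp (-σ * t) * φ t
  contDiff' := (Real.contDiff_exp.comp (contDiff_const.mul contDiff_id)).mul φ.contDiff
  hasCompactSupport' := φ.hasCompactSupport.mul_left
  tsupport_subset' := fun _ _ => trivial

/-- A real-valued test function on the line, seen as a complex Schwartz function. -/
noncomputable def toSchwartz (φ : 𝓓((⊤ : Opens ℝ), ℝ)) : 𝓢(ℝ, ℂ) :=
  HasCompactSupport.toSchwartzMap (f := fun t => (φ t : ℂ))
    (φ.hasCompactSupport.comp_left (g := fun r : ℝ => (r : ℂ)) Complex.ofReal_zero)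
    (Complex.ofRealCLM.contDiff.comp φ.contDiff)

/-- `g = e^{-σ t} f` as distributions on the line, with `g` tempered. -/
def IsWeighted (σ : ℝ) (f : 𝓓'((⊤ : Opens ℝ), X)) (g : 𝓢'(ℝ, X)) : Prop :=
  ∀ φ : 𝓓((⊤ : Opens ℝ), ℝ), g (toSchwartz φ) = f (expMul σ φ)

/-- `f` lies in `ℒ'_σ(ℝ, X)`, that is, `e^{-σ t} f` is tempered, and its Fourier-Laplace transform
`ℒ[f](ω) = ∫ e^{iωt} f(t) dt` on the line `Im ω = σ` is the function `ξ + iσ ↦ F ξ`.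
Since `ℒ[f](ξ + iσ)` is the Fourier transform `∫ e^{iξt} e^{-σt} f(t) dt` of `g = e^{-σ t} f`,
it is `𝓕⁻ g` at the point `ξ / (2π)` in Mathlib's normalization. -/
def HasLaplace (σ : ℝ) (f : 𝓓'((⊤ : Opens ℝ), X)) (F : ℝ → X) : Prop :=
  ∃ g : 𝓢'(ℝ, X), IsWeighted σ f g ∧
    ∀ Φ : 𝓢(ℝ, ℂ), Integrable (fun ν : ℝ => Φ ν • F (2 * Real.pi * ν)) ∧
      (𝓕⁻ g) Φ = ∫ ν : ℝ, Φ ν • F (2 * Real.pi * ν)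

/-- The number `(∫ |ω|^{2m} ‖F(ω)‖² dω)^{1/2}`, with `ω = ξ + iσ` running over the line
`Im ω = σ`. -/
noncomputable def weightedNorm (σ m : ℝ) (F : ℝ → X) : ℝ≥0∞ :=
  (∫⁻ ξ : ℝ, ENNReal.ofReal (‖(ξ + σ * Complex.I : ℂ)‖ ^ (2 * m)) * ‖F ξ‖ₑ ^ 2) ^ (1 / 2 : ℝ)

/-- Membership in the space `H_σ^m(ℝ, X)`. -/
def MemHsm (σ m : ℝ) (f : 𝓓'((⊤ : Opens ℝ), X)) : Prop :=
  ∃ F : ℝ → X, HasLaplace σ f F ∧ weightedNorm σ m F < ⊤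

/-- The norm of `H_σ^m(ℝ, X)`. The Fourier-Laplace transform `F` of `f` is unique up to
equality almost everywhere, so the infimum is over one single value; it is `∞` if `F` does
not exist. -/
noncomputable def normHsm (σ m : ℝ) (f : 𝓓'((⊤ : Opens ℝ), X)) : ℝ≥0∞ :=
  ⨅ (F : ℝ → X) (_ : HasLaplace σ f F), weightedNorm σ m F

/-- A causal signal: a distribution in time that vanishes on the negative half-line. -/
def IsCausal (f : 𝓓'((⊤ : Opens ℝ), X)) : Prop :=
  ∀ φ : 𝓓((⊤ : Opens ℝ), ℝ), tsupport φ ⊆ Set.Iio 0 → f φ = 0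

/-- The time derivative of a distribution in time. -/
noncomputable def dt (f : 𝓓'((⊤ : Opens ℝ), X)) : 𝓓'((⊤ : Opens ℝ), X) := ∂_{(1 : ℝ)} f

end Laplace

/-! ### The medium, the incident field and the scattering system -/

/-- The electric permittivity `ε` is a real `L^∞` function on `ℝ³` with a positive lower bound,
and `ε - ε₀` has compact support in `Ω`. -/
structure IsMedium (Ω : Opens R3) (ε₀ : ℝ) (ε : R3 → ℝ) : Prop where
  aemeasurable : AEMeasurable ε
  bounds : ∃ a b : ℝ, 0 < a ∧ ∀ᵐ x : R3, a ≤ ε x ∧ ε x ≤ b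
  support : ∃ K : Set R3, IsCompact K ∧ K ⊆ Ω ∧ ∀ᵐ x : R3, x ∉ K → ε x = ε₀

/-- An incident field on `Ω`: a causal signal whose sources lie outside `Ω`, so that in `Ω` it is
a wave in the vacuum, `∇ × ∇ × E + ε₀ μ₀ ∂²E/∂t² = 0` in the sense of distributions on `Ω × ℝ`. -/
structure IsIncident (Ω : Opens R3) (ε₀ μ₀ : ℝ) (E : 𝓓'((⊤ : Opens ℝ), L2On Ω)) : Prop where
  causal : IsCausal E
  vacuum : ∀ (φ : 𝓓((⊤ : Opens ℝ), ℝ)) (ψ : 𝓓(Ω, C3)),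
    (∫ x in (Ω : Set R3), dot3 (E φ x) (curl (curl ψ) x))
      + (ε₀ * μ₀ : ℝ) * ∫ x in (Ω : Set R3), dot3 (dt (dt E) φ x) (ψ x) = 0

/-- `(Es, Hs)` solves the Maxwell scattering system with incident field `Ei`:
`∇ × Es + μ₀ ∂Hs/∂t = 0` and `∇ × Hs - ε ∂Es/∂t = (ε - ε₀) ∂Ei/∂t` in the sense of distributions on
`ℝ³ × ℝ` (the right-hand side being `0` outside `Ω`), with zero initial data at time `0`: both
fields vanish for negative times. -/
structure IsScattered (Ω : Opens R3) (ε₀ μ₀ : ℝ) (ε : R3 → ℝ) (Ei : 𝓓'((⊤ : Opens ℝ), L2On Ω))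
    (Es : 𝓓'((⊤ : Opens ℝ), HCurl)) (Hs : 𝓓'((⊤ : Opens ℝ), L2R3)) : Prop where
  causal_E : IsCausal Es
  causal_H : IsCausal Hs
  faraday : ∀ φ : 𝓓((⊤ : Opens ℝ), ℝ), HCurl.curl (Es φ) + (μ₀ : ℂ) • dt Hs φ = 0
  ampere : ∀ φ : 𝓓((⊤ : Opens ℝ), ℝ), IsWeakCurl ⊤ (Hs φ) fun x =>
    (ε x : ℂ) • HCurl.field (dt Es φ) x
      + (Ω : Set R3).indicator (fun y => ((ε y - ε₀ : ℝ) : ℂ) • dt Ei φ y) x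

/-!
The Fourier-Laplace transform on the line `Im w = σ` turns `∂/∂t` into multiplication by `-iw`, so
that at a fixed frequency the electric field `u` scattered from the incident field `g` solves
`∇ × ∇ × u = w² μ₀ (ε u + (ε - ε₀) g)`. The sesquilinear form
`⟪∇ × v, ∇ × u⟫ - w² μ₀ ⟪v, ε u⟫` on `H(curl, ℝ³)` becomes coercive after a rotation by `i w̄`
(`im_mul_le_norm_mul`), so that it is invertible for `Im w > 0` (`isUnit_waveOp`) and defines the
solution operator `solOp`.

The estimate `‖u‖ ≤ C |w| ‖g‖` in `H(curl)`, uniform on the line (`exists_norm_solOp_le`), is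
sharper by one power of `|w|` than what coercivity gives directly, and it is here that the vacuum
equation for `g` is used. With a cutoff `χ` that is `1` on the support of `ε - ε₀`, the field
`U = u + χ g` solves an equation whose only sources are commutators of `χ` with `∇ × ∇ ×`. The
vacuum equation controls the curl of `g` on the support of `χ` by `|w| ‖g‖`
(`IsVacuum.exists_isCurl`): by duality this is a bound on the pairing of `χ g` with `∇ × Ψ`, and
`∇ × Ψ = κ² η + ∇ × ∇ × η` with `η = ∇ × (κ² - Δ)⁻¹ Ψ` and `κ` comparable to `|w|`. The sources
are therefore of the right order (`IsVacuum.exists_isCurl_cutoff`), and testing the equation with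
`U` gives the estimate.

Back in the time domain, a function on the line with a finite weighted norm is the transform of a
distribution (`exists_hasLaplace`), the transform is determined by the distribution
(`HasTransform.ae_eq_zero`), and the transform of an incident field satisfies the vacuum equation
at almost every frequency (`IsIncident.ae_isVacuum`).

Causality of the solution and uniqueness follow from the conservation of energy
(`IsMedium.eq_zero_of_maxwell`). For a distribution `f` with a transform and a test function `φ`,
the function `s ↦ f (φ(· - s))` is differentiable and decays at `-∞`
(`HasTransform.hasDerivAt_shift`, `HasTransform.tendsto_shift`); for the fields of a solution these
functions solve Maxwell's equations, and without sources they vanish. This uses that the curl with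
its maximal domain is symmetric (`IsCurl.inner_comm`), which holds because Schwartz fields are
dense in `H(curl)` (`curlGraph_le_closure_range`).
-/

/-! ### The curl on Schwartz fields -/

/-- The standard basis vectors of physical space. -/
noncomputable abbrev e3 (i : Fin 3) : R3 := EuclideanSpace.single i (1 : ℝ)

/-- The matrix of `a ↦ eᵢ × a`; these are the coefficients of the curl,
`∇ × ψ = ∑ᵢ eᵢ × ∂ᵢψ`. -/
noncomputable def crossE (i : Fin 3) : C3 →L[ℂ] C3 :=
  LinearMap.toContinuousLinearMap
    { toFun := fun a => match i with
        | 0 => !₂[0, -a 2, a 1]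
        | 1 => !₂[a 2, 0, -a 0]
        | 2 => !₂[-a 1, a 0, 0]
      map_add' := fun a b => by
        fin_cases i <;> ext j <;> fin_cases j <;> simp <;> ring
      map_smul' := fun c a => by
        fin_cases i <;> ext j <;> fin_cases j <;> simp }

@[simp] theorem crossE_zero (a : C3) : crossE 0 a = !₂[0, -a 2, a 1] := rfl

@[simp] theorem crossE_one (a : C3) : crossE 1 a = !₂[a 2, 0, -a 0] := rfl

@[simp] theorem crossE_two (a : C3) : crossE 2 a = !₂[-a 1, a 0, 0] := rfl

theorem curl_eq_sum_crossE (ψ : R3 → C3) (x : R3) :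
    curl ψ x = ∑ i, crossE i (fderiv ℝ ψ x (e3 i)) := by
  ext j
  fin_cases j <;> simp [curl, pd, Fin.sum_univ_three] <;> ring

/-- The curl as an operator on Schwartz fields. -/
noncomputable def curlS : 𝓢(R3, C3) →L[ℂ] 𝓢(R3, C3) :=
  ∑ i, SchwartzMap.postcompCLM (crossE i) ∘L LineDeriv.lineDerivOpCLM ℂ 𝓢(R3, C3) (e3 i)

theorem curlS_eq_sum (Ψ : 𝓢(R3, C3)) :
    curlS Ψ = ∑ i, SchwartzMap.postcompCLM (crossE i) (∂_{e3 i} Ψ) := by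
  simp [curlS]

theorem curlS_apply (Ψ : 𝓢(R3, C3)) (x : R3) : curlS Ψ x = curl Ψ x := by
  rw [curlS_eq_sum, curl_eq_sum_crossE]
  simp [SchwartzMap.lineDerivOp_apply_eq_fderiv]

/-- A constant matrix commutes with the Fourier transform. -/
theorem fourier_postcompCLM (L : C3 →L[ℂ] C3) (Ψ : 𝓢(R3, C3)) :
    𝓕 (SchwartzMap.postcompCLM L Ψ) = SchwartzMap.postcompCLM L (𝓕 Ψ) := by
  ext1 k
  rw [SchwartzMap.postcompCLM_apply, SchwartzMap.fourier_coe, SchwartzMap.fourier_coe,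
    Real.fourier_eq, Real.fourier_eq, ← ContinuousLinearMap.integral_comp_comm]
  · refine integral_congr_ae (Filter.Eventually.of_forall fun v => ?_)
    simp [Circle.smul_def]
  · exact (Real.fourierIntegral_convergent_iff k).2 Ψ.integrable

theorem fourier_lineDeriv_apply (Ψ : 𝓢(R3, C3)) (i : Fin 3) (k : R3) :
    𝓕 (∂_{e3 i} Ψ) k = (2 * Real.pi * Complex.I * k i : ℂ) • 𝓕 Ψ k := by
  rw [SchwartzMap.fourier_lineDerivOp_eq]
  have : (inner ℝ · (e3 i) : R3 → ℝ).HasTemperateGrowth := by fun_prop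
  rw [FunLike.coe_smul, Pi.smul_apply, SchwartzMap.smulLeftCLM_apply_apply this, mul_smul,
    ← Complex.coe_smul]
  simp [EuclideanSpace.inner_single_right, mul_smul]

theorem fourier_curlS_apply (Ψ : 𝓢(R3, C3)) (k : R3) :
    𝓕 (curlS Ψ) k = (2 * Real.pi * Complex.I : ℂ) • ∑ i, (k i : ℂ) • crossE i (𝓕 Ψ k) := by
  have h : 𝓕 (curlS Ψ) = ∑ i, SchwartzMap.postcompCLM (crossE i) (𝓕 (∂_{e3 i} Ψ)) := by
    rw [curlS_eq_sum]
    simp only [← fourier_postcompCLM]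
    exact map_sum (FourierTransform.fourierCLM ℂ 𝓢(R3, C3)) _ _
  rw [h]
  simp only [FunLike.coe_sum, Finset.sum_apply, SchwartzMap.postcompCLM_apply, fourier_lineDeriv_apply, map_smul,
    Finset.smul_sum, smul_smul]

/-- A Schwartz field as an element of `L²`. -/
noncomputable def toL2 : 𝓢(R3, C3) →L[ℂ] L2R3 := SchwartzMap.toLpCLM ℂ C3 2 (volume : Measure R3)

theorem coeFn_toL2 (Ψ : 𝓢(R3, C3)) : toL2 Ψ =ᵐ[volume] Ψ := Ψ.coeFn_toLp 2

theorem inner_toL2_toL2 (Φ Ψ : 𝓢(R3, C3)) :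
    inner ℂ (toL2 Φ) (toL2 Ψ) = ∫ x, inner ℂ (Φ x) (Ψ x) := by
  rw [L2.inner_def]
  refine integral_congr_ae ?_
  filter_upwards [coeFn_toL2 Φ, coeFn_toL2 Ψ] with x h1 h2
  rw [h1, h2]

/-- Plancherel's theorem as a comparison principle. -/
theorem norm_toL2_le_of_fourier_le {Φ Ψ : 𝓢(R3, C3)} {c : ℝ}
    (h : ∀ k, ‖𝓕 Φ k‖ ≤ c * ‖𝓕 Ψ k‖) : ‖toL2 Φ‖ ≤ c * ‖toL2 Ψ‖ := by
  have hP : ∀ Θ : 𝓢(R3, C3), ‖toL2 (𝓕 Θ)‖ = ‖toL2 Θ‖ := fun Θ => by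
    rw [norm_eq_sqrt_re_inner (𝕜 := ℂ), norm_eq_sqrt_re_inner (𝕜 := ℂ) (toL2 Θ),
      inner_toL2_toL2, inner_toL2_toL2, SchwartzMap.integral_inner_fourier_fourier]
  rw [← hP Φ, ← hP Ψ]
  refine Lp.norm_le_mul_norm_of_ae_le_mul ?_
  filter_upwards [coeFn_toL2 (𝓕 Φ), coeFn_toL2 (𝓕 Ψ)] with k h1 h2
  rw [h1, h2]
  exact h k

theorem norm_crossE_apply_le (i : Fin 3) (a : C3) : ‖crossE i a‖ ≤ ‖a‖ := by
  refine le_of_sq_le_sq ?_ (norm_nonneg a)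
  rw [EuclideanSpace.norm_sq_eq, EuclideanSpace.norm_sq_eq]
  fin_cases i <;> simp [Fin.sum_univ_three] <;> nlinarith [sq_nonneg ‖a 0‖, sq_nonneg ‖a 1‖, sq_nonneg ‖a 2‖]

/-- The identity `k × (k × (k × a)) = -|k|² k × a` behind `∇ × ∇ × ∇ × = -Δ ∇ ×`. -/
theorem sum_crossE_triple (k : R3) (a : C3) :
    (∑ i, (k i : ℂ) • crossE i (∑ i, (k i : ℂ) • crossE i (∑ i, (k i : ℂ) • crossE i a))) =
      -((k 0 ^ 2 + k 1 ^ 2 + k 2 ^ 2 : ℝ) : ℂ) • ∑ i, (k i : ℂ) • crossE i a := by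
  ext l
  fin_cases l <;> simp [Fin.sum_univ_three] <;> ring

theorem sum_crossE_smul (k : R3) (c : ℂ) (a : C3) :
    (∑ i, (k i : ℂ) • crossE i (c • a)) = c • ∑ i, (k i : ℂ) • crossE i a := by
  simp only [map_smul, Finset.smul_sum, smul_smul, mul_comm]

/-- The symbol `(κ² + |2πk|²)⁻¹` of the resolvent of the Laplacian. -/
noncomputable def resolventSymbol (κ : ℝ) (k : R3) : ℝ := (κ ^ 2 + (2 * Real.pi) ^ 2 * ‖k‖ ^ 2)⁻¹

theorem hasTemperateGrowth_resolventSymbol {κ : ℝ} (hκ : 0 < κ) :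
    (resolventSymbol κ).HasTemperateGrowth := by
  have h1 := Function.hasTemperateGrowth_one_add_norm_sq_rpow R3 (-1)
  let L : R3 →L[ℝ] R3 := (2 * Real.pi / κ) • ContinuousLinearMap.id ℝ R3
  have h2 := h1.comp L.hasTemperateGrowth
  -- scaling reduces the symbol to `(1 + |x|²)⁻¹`
  have h3 : resolventSymbol κ =
      fun k => (κ ^ 2)⁻¹ * ((fun x : R3 => (1 + ‖x‖ ^ 2) ^ (-1 : ℝ)) ∘ L) k := by
    funext k
    have : 0 < 1 + ‖(2 * Real.pi / κ) • k‖ ^ 2 := by positivity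
    simp only [resolventSymbol, Function.comp, L, smul_apply,
      ContinuousLinearMap.id_apply]
    rw [Real.rpow_neg_one, ← mul_inv, norm_smul, Real.norm_of_nonneg (by positivity)]
    congr 1
    field_simp
  rw [h3]
  exact (Function.HasTemperateGrowth.const _).mul h2

/-- For a Schwartz field `Ψ` and `κ > 0` the field `η = ∇ × (κ² - Δ)⁻¹ Ψ` is divergence free, so
that `κ² η + ∇ × ∇ × η = ∇ × Ψ`, and gains two derivatives on `∇ × Ψ`, with bounds that are
uniform in `κ`. -/
theorem exists_curlS_resolvent {κ : ℝ} (hκ : 0 < κ) (Ψ : 𝓢(R3, C3)) :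
    ∃ η : 𝓢(R3, C3), (κ ^ 2 : ℂ) • η + curlS (curlS η) = curlS Ψ ∧
      ‖toL2 η‖ ≤ 3 / κ * ‖toL2 Ψ‖ ∧ ∀ j, ‖toL2 (∂_{e3 j} η)‖ ≤ 3 * ‖toL2 Ψ‖ := by
  have hg := hasTemperateGrowth_resolventSymbol hκ
  let φ : 𝓢(R3, C3) := 𝓕⁻ (SchwartzMap.smulLeftCLM C3 (resolventSymbol κ) (𝓕 Ψ))
  have hφ : ∀ k, 𝓕 φ k = (resolventSymbol κ k : ℂ) • 𝓕 Ψ k := fun k => by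
    simp only [φ, FourierTransform.fourier_fourierInv_eq]
    rw [SchwartzMap.smulLeftCLM_apply_apply hg, Complex.coe_smul]
  have hpos : ∀ k : R3, 0 < κ ^ 2 + (2 * Real.pi) ^ 2 * ‖k‖ ^ 2 := fun k => by positivity
  have hki : ∀ (k : R3) i, |k i| ≤ ‖k‖ := fun k i => by
    simpa using PiLp.norm_apply_le k i
  have hη : ∀ k, ‖𝓕 (curlS φ) k‖ ≤ 3 * (2 * Real.pi * ‖k‖) * resolventSymbol κ k * ‖𝓕 Ψ k‖ := by
    intro k
    have h0 : 0 ≤ resolventSymbol κ k := (inv_pos.2 (hpos k)).le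
    have hs : ‖∑ i, (k i : ℂ) • crossE i (𝓕 φ k)‖ ≤ 3 * (‖k‖ * ‖𝓕 φ k‖) := by
      refine (norm_sum_le _ _).trans ?_
      have : ∀ i ∈ Finset.univ, ‖(k i : ℂ) • crossE i (𝓕 φ k)‖ ≤ ‖k‖ * ‖𝓕 φ k‖ := fun i _ => by
        rw [norm_smul, Complex.norm_real]
        exact mul_le_mul (hki k i) (norm_crossE_apply_le i _) (norm_nonneg _) (norm_nonneg _)
      simpa using Finset.sum_le_sum this
    rw [fourier_curlS_apply, norm_smul]
    rw [hφ, norm_smul, Complex.norm_real, Real.norm_of_nonneg h0] at hs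
    have hn : ‖(2 * Real.pi * Complex.I : ℂ)‖ = 2 * Real.pi := by
      simp [abs_of_pos Real.pi_pos]
    rw [hn, hφ]
    calc _ ≤ 2 * Real.pi * (3 * (‖k‖ * (resolventSymbol κ k * ‖𝓕 Ψ k‖))) := by gcongr
      _ = _ := by ring
  -- the equation holds since `κ² + |2πk|²` is the symbol of `κ² + ∇ × ∇ ×` on curls; the two bounds
  -- amount to `2πκ|k| ≤ κ² + |2πk|²` and `|2πk|² ≤ κ² + |2πk|²`
  refine ⟨curlS φ, ?_, ?_, fun j => ?_⟩
  · refine (FourierTransform.fourierCLE ℂ 𝓢(R3, C3)).injective ?_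
    ext1 k
    have e1 : (FourierTransform.fourierCLE ℂ 𝓢(R3, C3)) ((κ ^ 2 : ℂ) • curlS φ + curlS (curlS (curlS φ)))
      = (κ ^ 2 : ℂ) • 𝓕 (curlS φ) + 𝓕 (curlS (curlS (curlS φ))) := by
      rw [map_add, map_smul]; rfl
    have e2 : (FourierTransform.fourierCLE ℂ 𝓢(R3, C3)) (curlS Ψ) = 𝓕 (curlS Ψ) := rfl
    have e3 : 𝓕 Ψ k = ((κ ^ 2 + (2 * Real.pi) ^ 2 * (k 0 ^ 2 + k 1 ^ 2 + k 2 ^ 2) : ℝ) : ℂ) • 𝓕 φ k := by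
      rw [hφ, smul_smul, ← Complex.ofReal_mul]
      have : κ ^ 2 + (2 * Real.pi) ^ 2 * (k 0 ^ 2 + k 1 ^ 2 + k 2 ^ 2) =
          κ ^ 2 + (2 * Real.pi) ^ 2 * ‖k‖ ^ 2 := by
        rw [EuclideanSpace.norm_sq_eq]
        simp [Fin.sum_univ_three]
      rw [this, resolventSymbol, mul_inv_cancel₀ (hpos k).ne', Complex.ofReal_one, one_smul]
    rw [e1, e2, FunLike.coe_add, Pi.add_apply, FunLike.coe_smul, Pi.smul_apply]
    simp only [fourier_curlS_apply, e3]
    simp only [sum_crossE_smul, sum_crossE_triple, smul_smul, ← add_smul]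
    congr 1
    push_cast
    linear_combination (-(2 * Real.pi) ^ 3 * Complex.I * (k 0 ^ 2 + k 1 ^ 2 + k 2 ^ 2) : ℂ) *
      Complex.I_sq
  · refine norm_toL2_le_of_fourier_le fun k => (hη k).trans ?_
    gcongr
    rw [resolventSymbol, ← div_eq_mul_inv, div_le_div_iff₀ (hpos k) hκ]
    nlinarith [sq_nonneg (κ - 2 * Real.pi * ‖k‖)]
  · refine norm_toL2_le_of_fourier_le fun k => ?_
    rw [fourier_lineDeriv_apply, norm_smul]
    have hn : ‖(2 * Real.pi * Complex.I * k j : ℂ)‖ ≤ 2 * Real.pi * ‖k‖ := by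
      simpa [abs_of_pos Real.pi_pos] using
        mul_le_mul_of_nonneg_left (hki k j) (by positivity : 0 ≤ 2 * Real.pi)
    calc _ ≤ 2 * Real.pi * ‖k‖ * (3 * (2 * Real.pi * ‖k‖) * resolventSymbol κ k * ‖𝓕 Ψ k‖) := by
          gcongr
          exact hη k
      _ = 3 * (((2 * Real.pi) ^ 2 * ‖k‖ ^ 2) * resolventSymbol κ k) * ‖𝓕 Ψ k‖ := by ring
      _ ≤ 3 * 1 * ‖𝓕 Ψ k‖ := by
          gcongr
          rw [resolventSymbol, ← div_eq_mul_inv, div_le_one (hpos k)]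
          nlinarith
      _ = _ := by ring

/-! ### The curl as an unbounded operator on `L²` -/

/-- `∇ × u = c` in `L²`, tested against Schwartz fields in the Hermitian pairing of `L²`. -/
def IsCurl (u c : L2R3) : Prop :=
  ∀ Ψ : 𝓢(R3, C3), inner ℂ (toL2 (curlS Ψ)) u = inner ℂ (toL2 Ψ) c

theorem IsCurl.add {u c v d : L2R3} (h : IsCurl u c) (h' : IsCurl v d) :
    IsCurl (u + v) (c + d) := fun Ψ => by
  rw [inner_add_right, inner_add_right, h, h']

theorem IsCurl.smul {u c : L2R3} (h : IsCurl u c) (a : ℂ) : IsCurl (a • u) (a • c) := fun Ψ => by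
  rw [inner_smul_right, inner_smul_right, h]

theorem IsCurl.neg {u c : L2R3} (h : IsCurl u c) : IsCurl (-u) (-c) := by
  simpa using h.smul (-1)

theorem IsCurl.sub {u c v d : L2R3} (h : IsCurl u c) (h' : IsCurl v d) :
    IsCurl (u - v) (c - d) := by
  simpa [sub_eq_add_neg] using h.add h'.neg

/-- Schwartz fields are dense in `L²`. -/
theorem eq_zero_of_inner_toLp_eq_zero {u : L2R3}
    (h : ∀ Ψ : 𝓢(R3, C3), inner ℂ (toL2 Ψ) u = 0) : u = 0 := by
  have hd : DenseRange toL2 :=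
    SchwartzMap.denseRange_toLpCLM (by norm_num)
  have : ∀ v : L2R3, inner ℂ v u = 0 := fun v => by
    refine hd.induction_on (p := fun v => inner ℂ v u = 0) v
      (isClosed_eq (by fun_prop) continuous_const) fun Ψ => h Ψ
  exact inner_self_eq_zero.1 (this u)

theorem IsCurl.unique {u c d : L2R3} (h : IsCurl u c) (h' : IsCurl u d) : c = d := by
  refine sub_eq_zero.1 (eq_zero_of_inner_toLp_eq_zero fun Ψ => ?_)
  rw [inner_sub_right, ← h, ← h', sub_self]

theorem isClosed_isCurl : IsClosed {p : WithLp 2 (L2R3 × L2R3) | IsCurl p.fst p.snd} := by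
  have : {p : WithLp 2 (L2R3 × L2R3) | IsCurl p.fst p.snd} = ⋂ Ψ : 𝓢(R3, C3),
      {p | inner ℂ (toL2 (curlS Ψ)) p.fst = inner ℂ (toL2 Ψ) p.snd} := by
    ext p; simp [IsCurl]
  rw [this]
  exact isClosed_iInter fun Ψ => isClosed_eq
    (continuous_const.inner (WithLp.prod_continuous_ofLp 2 L2R3 L2R3).fst)
    (continuous_const.inner (WithLp.prod_continuous_ofLp 2 L2R3 L2R3).snd)

/-- The curl is symmetric on Schwartz fields. -/
theorem isCurl_toLp (Ψ : 𝓢(R3, C3)) : IsCurl (toL2 Ψ) (toL2 (curlS Ψ)) := fun Φ => by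
  rw [inner_toL2_toL2, inner_toL2_toL2, ← SchwartzMap.integral_inner_fourier_fourier,
    ← SchwartzMap.integral_inner_fourier_fourier Φ]
  refine integral_congr_ae (Filter.Eventually.of_forall fun k => ?_)
  simp only [fourier_curlS_apply]
  generalize 𝓕 Φ k = a
  generalize 𝓕 Ψ k = b
  have h2 : (starRingEnd ℂ) 2 = 2 := Complex.conj_ofNat 2
  simp [PiLp.inner_apply, Fin.sum_univ_three, h2]
  ring

/-- The graph of the curl on `L²`, with the graph norm. -/
noncomputable def curlGraph : Submodule ℂ (WithLp 2 (L2R3 × L2R3)) where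
  carrier := {p | IsCurl p.fst p.snd}
  zero_mem' := fun Ψ => by simp
  add_mem' := fun hp hq => hp.add hq
  smul_mem' := fun c _ hp => hp.smul c

/-- The graph of the curl on Schwartz fields. -/
noncomputable def curlGraphS : 𝓢(R3, C3) →ₗ[ℂ] WithLp 2 (L2R3 × L2R3) where
  toFun Ψ := WithLp.toLp 2 (toL2 Ψ, toL2 (curlS Ψ))
  map_add' Φ Ψ := by simp only [map_add]; rfl
  map_smul' c Ψ := by simp only [map_smul]; rfl

/-- Schwartz fields are dense in the domain of the curl: a pair `(p, ∇ × p)` orthogonal to them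
satisfies `∇ × ∇ × p = -p`; tested against `η = ∇ × (1 - Δ)⁻¹ Ψ` this says `∇ × p = 0`. -/
theorem curlGraph_le_closure_range :
    curlGraph ≤ (LinearMap.range curlGraphS).topologicalClosure := by
  set S := (LinearMap.range curlGraphS).topologicalClosure with hS
  have hSle : S ≤ curlGraph := by
    refine Submodule.topologicalClosure_minimal _ ?_ isClosed_isCurl
    rintro _ ⟨Ψ, rfl⟩
    exact isCurl_toLp Ψ
  have : CompleteSpace S := (Submodule.isClosed_topologicalClosure _).completeSpace_coe
  intro x hx
  -- `p` is the component of `x` orthogonal to the closure of the Schwartz fields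
  obtain ⟨y, hy, p, hp, rfl⟩ := S.exists_add_mem_mem_orthogonal x
  have hpg : IsCurl p.fst p.snd := by
    have := curlGraph.sub_mem hx (hSle hy)
    rw [add_sub_cancel_left] at this
    exact this
  have hort : ∀ Ψ : 𝓢(R3, C3),
      inner ℂ (toL2 Ψ) p.fst + inner ℂ (toL2 (curlS Ψ)) p.snd = 0 := fun Ψ => by
    have := (Submodule.mem_orthogonal _ _).1 hp (curlGraphS Ψ)
      (Submodule.le_topologicalClosure _ ⟨Ψ, rfl⟩)
    simpa [WithLp.prod_inner_apply, curlGraphS] using this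
  have hq : p.snd = 0 := by
    refine eq_zero_of_inner_toLp_eq_zero fun Ψ => ?_
    obtain ⟨η, hη, -, -⟩ := exists_curlS_resolvent one_pos Ψ
    rw [← hpg Ψ, ← hη, map_add, map_smul, inner_add_left, hpg (curlS η), inner_smul_left]
    simpa using hort η
  have hp0 : p.fst = 0 := by
    refine eq_zero_of_inner_toLp_eq_zero fun Ψ => ?_
    simpa [hq] using hort Ψ
  have : p = 0 := (WithLp.ofLp_injective 2) (Prod.ext hp0 hq)
  rw [this, add_zero]
  exact hy

/-- The curl with its maximal domain in `L²` is symmetric. -/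
theorem IsCurl.inner_comm {u c v d : L2R3} (h : IsCurl u c) (h' : IsCurl v d) :
    inner ℂ c v = inner ℂ u d := by
  have hcl : IsClosed {p : WithLp 2 (L2R3 × L2R3) | inner ℂ p.snd v = inner ℂ p.fst d} :=
    isClosed_eq ((WithLp.prod_continuous_ofLp 2 L2R3 L2R3).snd.inner continuous_const)
      ((WithLp.prod_continuous_ofLp 2 L2R3 L2R3).fst.inner continuous_const)
  have hsub : ((LinearMap.range curlGraphS).topologicalClosure : Set _) ⊆
      {p : WithLp 2 (L2R3 × L2R3) | inner ℂ p.snd v = inner ℂ p.fst d} := by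
    refine closure_minimal ?_ hcl
    rintro _ ⟨Ψ, rfl⟩
    exact h' Ψ
  exact hsub (curlGraph_le_closure_range (x := WithLp.toLp 2 (u, c)) h)

/-- A linear functional on a subspace of a Hilbert space that is bounded in norm is represented by
a vector. -/
theorem exists_inner_eq_of_bound {E H : Type*} [AddCommGroup E] [Module ℂ E]
    [NormedAddCommGroup H] [InnerProductSpace ℂ H] [CompleteSpace H] (ι : E →ₗ[ℂ] H)
    (hι : Function.Injective ι) (T : E →ₗ[ℂ] ℂ) {b : ℝ} (hb : 0 ≤ b)
    (hT : ∀ x, ‖T x‖ ≤ b * ‖ι x‖) : ∃ c : H, ‖c‖ ≤ b ∧ ∀ x, inner ℂ c (ι x) = T x := by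
  let f : LinearMap.range ι →L[ℂ] ℂ :=
    (T ∘ₗ (LinearEquiv.ofInjective ι hι).symm.toLinearMap).mkContinuous b fun y => by
      obtain ⟨x, rfl⟩ := (LinearEquiv.ofInjective ι hι).surjective y
      simpa using hT x
  obtain ⟨g, hg, hn⟩ := exists_extension_norm_eq (LinearMap.range ι) f
  refine ⟨(InnerProductSpace.toDual ℂ H).symm g, ?_, fun x => ?_⟩
  · rw [LinearIsometryEquiv.norm_map, hn]
    exact LinearMap.mkContinuous_norm_le _ hb _
  · rw [InnerProductSpace.toDual_symm_apply]
    have := hg ⟨ι x, ⟨x, rfl⟩⟩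
    rw [this]
    change T ((LinearEquiv.ofInjective ι hι).symm ((LinearEquiv.ofInjective ι hι) x)) = T x
    simp

/-- The maximal domain of the curl by duality: `w` has a curl in `L²` as soon as its pairing with
`∇ × Ψ` is bounded by the `L²` norm of `Ψ`. -/
theorem exists_isCurl_of_bound {w : L2R3} {b : ℝ} (hb : 0 ≤ b)
    (h : ∀ Ψ : 𝓢(R3, C3), ‖inner ℂ (toL2 (curlS Ψ)) w‖ ≤ b * ‖toL2 Ψ‖) :
    ∃ c, IsCurl w c ∧ ‖c‖ ≤ b := by
  let T : 𝓢(R3, C3) →ₗ[ℂ] ℂ :=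
    (innerSL ℂ w).toLinearMap ∘ₗ toL2.toLinearMap ∘ₗ
      curlS.toLinearMap
  obtain ⟨c, hc, hcT⟩ := exists_inner_eq_of_bound
    toL2.toLinearMap
    (SchwartzMap.injective_toLp 2 (volume : Measure R3)) T hb fun Ψ => by
      have := h Ψ
      rwa [← inner_conj_symm, RCLike.norm_conj] at this
  refine ⟨c, fun Ψ => ?_, hc⟩
  have := congrArg (starRingEnd ℂ) (hcT Ψ)
  rw [inner_conj_symm] at this
  exact (inner_conj_symm _ _).symm.trans this.symm

/-! ### Multiplication operators -/

open Classical in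
/-- Multiplication of `L²` fields by an essentially bounded matrix field; `0` if the matrix field
is not in `L^∞`. -/
noncomputable def mulL (A : R3 → C3 →L[ℂ] C3) : L2R3 →L[ℂ] L2R3 :=
  if h : MemLp A ∞ (volume : Measure R3) then
    (ContinuousLinearMap.id ℂ (C3 →L[ℂ] C3)).holderL (volume : Measure R3) ∞ 2 2 (h.toLp A)
  else 0

theorem mulL_coeFn {A : R3 → C3 →L[ℂ] C3} (hA : MemLp A ∞ (volume : Measure R3)) (u : L2R3) :
    mulL A u =ᵐ[volume] fun x => A x (u x) := by
  rw [mulL, dif_pos hA]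
  filter_upwards [hA.coeFn_toLp,
    (ContinuousLinearMap.id ℂ (C3 →L[ℂ] C3)).coeFn_holder (r := 2) (hA.toLp A) u] with x h1 h2
  rw [h1] at h2
  exact h2

/-- The matrix field `a(x) I` for a real function `a`. -/
noncomputable def scalarField (a : R3 → ℝ) (x : R3) : C3 →L[ℂ] C3 :=
  (a x : ℂ) • ContinuousLinearMap.id ℂ C3

theorem memLp_scalarField {a : R3 → ℝ} (ha : MemLp a ∞ (volume : Measure R3)) :
    MemLp (scalarField a) ∞ (volume : Measure R3) := by
  let L : ℝ →L[ℝ] (C3 →L[ℂ] C3) :=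
    ContinuousLinearMap.smulRight (Complex.ofRealCLM) (ContinuousLinearMap.id ℂ C3)
  exact L.comp_memLp' ha

theorem mulL_scalarField_coeFn {a : R3 → ℝ} (ha : MemLp a ∞ (volume : Measure R3)) (u : L2R3) :
    mulL (scalarField a) u =ᵐ[volume] fun x => (a x : ℂ) • u x :=
  (mulL_coeFn (memLp_scalarField ha) u).trans (by simp [scalarField])

theorem inner_mulL_scalarField {a : R3 → ℝ} (ha : MemLp a ∞ (volume : Measure R3)) (u v : L2R3) :
    inner ℂ (mulL (scalarField a) u) v = inner ℂ u (mulL (scalarField a) v) := by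
  rw [L2.inner_def, L2.inner_def]
  refine integral_congr_ae ?_
  filter_upwards [mulL_scalarField_coeFn ha u, mulL_scalarField_coeFn ha v] with x h1 h2
  simp only [h1, h2, inner_smul_left, inner_smul_right, Complex.conj_ofReal]

/-- Pointwise application of a Schwartz matrix field to a Schwartz vector field. -/
noncomputable abbrev matS (A : 𝓢(R3, C3 →L[ℂ] C3)) : 𝓢(R3, C3) →L[ℂ] 𝓢(R3, C3) :=
  SchwartzMap.pairing (ContinuousLinearMap.id ℂ (C3 →L[ℂ] C3)) A

theorem matS_apply (A : 𝓢(R3, C3 →L[ℂ] C3)) (Ψ : 𝓢(R3, C3)) (x : R3) :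
    matS A Ψ x = A x (Ψ x) := rfl

theorem toL2_matS (A : 𝓢(R3, C3 →L[ℂ] C3)) (Ψ : 𝓢(R3, C3)) :
    toL2 (matS A Ψ) = mulL A (toL2 Ψ) := by
  refine Lp.ext ?_
  filter_upwards [coeFn_toL2 (matS A Ψ), coeFn_toL2 Ψ, mulL_coeFn A.memLp_top (toL2 Ψ)]
    with x h1 h2 h3
  rw [h1, h3, h2, matS_apply]

theorem lineDeriv_matS (A : 𝓢(R3, C3 →L[ℂ] C3)) (Ψ : 𝓢(R3, C3)) (v : R3) :
    ∂_{v} (matS A Ψ) = matS (∂_{v} A) Ψ + matS A (∂_{v} Ψ) := by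
  ext1 x
  rw [FunLike.coe_add, Pi.add_apply, matS_apply, matS_apply,
    SchwartzMap.lineDerivOp_apply_eq_fderiv, SchwartzMap.lineDerivOp_apply_eq_fderiv,
    SchwartzMap.lineDerivOp_apply_eq_fderiv]
  have h := ((ContinuousLinearMap.id ℂ (C3 →L[ℂ] C3)).bilinearRestrictScalars ℝ).hasFDerivAt_of_bilinear
    (A.hasFDerivAt x) (Ψ.hasFDerivAt x)
  have h' : HasFDerivAt (matS A Ψ) _ x := h
  rw [h'.fderiv]
  simp [add_comm]

theorem norm_toL2_curlS_le (Ψ : 𝓢(R3, C3)) :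
    ‖toL2 (curlS Ψ)‖ ≤ ∑ i, ‖toL2 (∂_{e3 i} Ψ)‖ := by
  rw [curlS_eq_sum, map_sum]
  refine (norm_sum_le _ _).trans (Finset.sum_le_sum fun i _ => Lp.norm_le_norm_of_ae_le ?_)
  filter_upwards [coeFn_toL2 (SchwartzMap.postcompCLM (crossE i) (∂_{e3 i} Ψ)),
    coeFn_toL2 (∂_{e3 i} Ψ)] with x h1 h2
  rw [h1, h2, SchwartzMap.postcompCLM_apply]
  exact norm_crossE_apply_le _ _

theorem norm_toL2_matS_le (A : 𝓢(R3, C3 →L[ℂ] C3)) (Ψ : 𝓢(R3, C3)) :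
    ‖toL2 (matS A Ψ)‖ ≤ ‖mulL A‖ * ‖toL2 Ψ‖ := by
  rw [toL2_matS]
  exact ContinuousLinearMap.le_opNorm _ _

/-! ### Cutoffs and local regularity of the vacuum field -/

/-- The matrix field of `a ↦ ∇χ × a`, for `X = χ I`; it is the commutator of the curl with the
multiplication by `χ`. -/
noncomputable def crossGrad (X : 𝓢(R3, C3 →L[ℂ] C3)) : 𝓢(R3, C3 →L[ℂ] C3) :=
  ∑ i, SchwartzMap.postcompCLM (ContinuousLinearMap.compL ℂ C3 C3 C3 (crossE i)) (∂_{e3 i} X)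

theorem crossGrad_apply (X : 𝓢(R3, C3 →L[ℂ] C3)) (x : R3) :
    crossGrad X x = ∑ i, (crossE i).comp (∂_{e3 i} X x) := by
  simp [crossGrad]

/-- The product rule `∇ × (χ Ψ) = χ ∇ × Ψ + ∇χ × Ψ`. -/
theorem curlS_matS {X : 𝓢(R3, C3 →L[ℂ] C3)} {χ : R3 → ℝ} (hX : ∀ x, X x = scalarField χ x)
    (Ψ : 𝓢(R3, C3)) :
    curlS (matS X Ψ) = matS X (curlS Ψ) + matS (crossGrad X) Ψ := by
  ext1 x
  rw [FunLike.coe_add, Pi.add_apply, matS_apply, matS_apply, crossGrad_apply, curlS_eq_sum,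
    curlS_eq_sum]
  simp only [lineDeriv_matS, FunLike.coe_sum, Finset.sum_apply, SchwartzMap.postcompCLM_apply,
    FunLike.coe_add, Pi.add_apply, matS_apply, map_add, map_sum, Finset.sum_add_distrib,
    ContinuousLinearMap.comp_apply]
  rw [add_comm]
  congr 1
  simp [hX, scalarField]

/-- `∇ × ∇ × g = k² g` in the sense of distributions on `Ω`, for the `L²` field `g`. -/
def IsVacuum (Ω : Opens R3) (k2 : ℂ) (g : L2R3) : Prop :=
  ∀ Θ : 𝓢(R3, C3), HasCompactSupport Θ → tsupport Θ ⊆ Ω →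
    inner ℂ (toL2 (curlS (curlS Θ))) g = k2 * inner ℂ (toL2 Θ) g

/-- A smooth cutoff `χ` with compact support in `Ω`, with the Schwartz matrix field `X = χ I`. -/
structure IsCutoff (Ω : Opens R3) (χ : R3 → ℝ) (X : 𝓢(R3, C3 →L[ℂ] C3)) : Prop where
  eq : ∀ x, X x = scalarField χ x
  hasCompactSupport : HasCompactSupport χ
  tsupport_subset : tsupport χ ⊆ Ω
  memLp : MemLp χ ∞ (volume : Measure R3)

theorem IsCutoff.support_subset {Ω : Opens R3} {χ : R3 → ℝ} {X : 𝓢(R3, C3 →L[ℂ] C3)}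
    (h : IsCutoff Ω χ X) : Function.support X ⊆ Function.support χ := fun x hx => by
  contrapose! hx
  simp only [Function.mem_support, not_not] at hx ⊢
  ext1 a
  simp [h.eq, scalarField, hx]

theorem support_matS_subset (A : 𝓢(R3, C3 →L[ℂ] C3)) (Ψ : 𝓢(R3, C3)) :
    Function.support (matS A Ψ) ⊆ Function.support A := fun x hx => by
  contrapose! hx
  simp only [Function.mem_support, not_not] at hx ⊢
  simp [hx]

theorem support_crossGrad_subset (X : 𝓢(R3, C3 →L[ℂ] C3)) :
    Function.support (crossGrad X) ⊆ tsupport X := fun x hx => by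
  contrapose! hx
  have h0 : ∀ i, ∂_{e3 i} X x = 0 := fun i => by
    have := SchwartzMap.tsupport_lineDerivOp_subset (e3 i) X
    exact image_eq_zero_of_notMem_tsupport fun h => hx (this h)
  simp [crossGrad_apply, h0]

theorem support_curlS_subset (Ψ : 𝓢(R3, C3)) : Function.support (curlS Ψ) ⊆ tsupport Ψ :=
  fun x hx => by
  contrapose! hx
  have h0 : ∀ i, ∂_{e3 i} Ψ x = 0 := fun i => by
    have := SchwartzMap.tsupport_lineDerivOp_subset (e3 i) Ψ
    exact image_eq_zero_of_notMem_tsupport fun h => hx (this h)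
  simp [curlS_eq_sum, h0]

theorem IsCutoff.mulL_eq {Ω : Opens R3} {χ : R3 → ℝ} {X : 𝓢(R3, C3 →L[ℂ] C3)}
    (h : IsCutoff Ω χ X) : mulL X = mulL (scalarField χ) :=
  congrArg mulL (funext h.eq)

theorem IsCutoff.inner_mulL {Ω : Opens R3} {χ : R3 → ℝ} {X : 𝓢(R3, C3 →L[ℂ] C3)}
    (h : IsCutoff Ω χ X) (Ψ : 𝓢(R3, C3)) (g : L2R3) :
    inner ℂ (toL2 Ψ) (mulL X g) = inner ℂ (toL2 (matS X Ψ)) g := by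
  rw [toL2_matS, h.mulL_eq, inner_mulL_scalarField h.memLp]

theorem curlS_curlS_matS {X : 𝓢(R3, C3 →L[ℂ] C3)} {χ : R3 → ℝ}
    (hX : ∀ x, X x = scalarField χ x) (Ψ : 𝓢(R3, C3)) :
    curlS (curlS (matS X Ψ)) =
      matS X (curlS (curlS Ψ)) + matS (crossGrad X) (curlS Ψ) + curlS (matS (crossGrad X) Ψ) := by
  rw [curlS_matS hX Ψ, map_add, curlS_matS hX (curlS Ψ)]

/-- The pairing of `∇ × ∇ × Ψ` with a cutoff vacuum field: the commutator of `∇ × ∇ ×` with the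
cutoff is of first order. -/
theorem IsVacuum.inner_curlS_curlS {Ω : Opens R3} {k2 : ℂ} {g : L2R3} (hg : IsVacuum Ω k2 g)
    {χ : R3 → ℝ} {X : 𝓢(R3, C3 →L[ℂ] C3)} (hX : IsCutoff Ω χ X) (Ψ : 𝓢(R3, C3)) :
    inner ℂ (toL2 (curlS (curlS Ψ))) (mulL X g) = k2 * inner ℂ (toL2 Ψ) (mulL X g)
      - inner ℂ (toL2 (matS (crossGrad X) (curlS Ψ))) g
      - inner ℂ (toL2 (curlS (matS (crossGrad X) Ψ))) g := by
  have hsupp : tsupport (matS X Ψ) ⊆ tsupport χ :=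
    closure_mono ((support_matS_subset X Ψ).trans hX.support_subset)
  have h1 := hg (matS X Ψ) (hX.hasCompactSupport.of_isClosed_subset (isClosed_tsupport _) hsupp)
    (hsupp.trans hX.tsupport_subset)
  rw [curlS_curlS_matS hX.eq, map_add, map_add, inner_add_left, inner_add_left] at h1
  rw [hX.inner_mulL, hX.inner_mulL]
  linear_combination h1

/-- Interior regularity: a field with `∇ × ∇ × g = k² g` on `Ω` has its curl in `L²` locally, with
a bound of first order in `|k|`. Proved by duality, testing with the resolvent of the Laplacian
at the energy `-κ²`. -/
theorem IsVacuum.exists_isCurl {Ω : Opens R3} {χ : R3 → ℝ} {X : 𝓢(R3, C3 →L[ℂ] C3)}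
    (hX : IsCutoff Ω χ X) {κ₀ : ℝ} (hκ₀ : 0 < κ₀) :
    ∃ C : ℝ, 0 ≤ C ∧ ∀ κ : ℝ, κ₀ ≤ κ → ∀ k2 : ℂ, ‖k2‖ ≤ κ ^ 2 → ∀ g, IsVacuum Ω k2 g →
      ∃ c, IsCurl (mulL X g) c ∧ ‖c‖ ≤ C * κ * ‖g‖ := by
  set N := crossGrad X
  set D : ℝ := ∑ i, ‖mulL ⇑(∂_{e3 i} N : 𝓢(R3, C3 →L[ℂ] C3))‖ with hD
  have hD0 : 0 ≤ D := Finset.sum_nonneg fun i _ => norm_nonneg _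
  refine ⟨6 * ‖mulL X‖ + 18 * ‖mulL N‖ / κ₀ + 3 * D / κ₀ ^ 2, by positivity, ?_⟩
  intro κ hκ k2 hk2 g hg
  have hκ' : 0 < κ := hκ₀.trans_le hκ
  refine exists_isCurl_of_bound (by positivity) fun Ψ => ?_
  obtain ⟨η, hη, hη0, hη1⟩ := exists_curlS_resolvent hκ' Ψ
  set b := ‖toL2 Ψ‖
  have hb : 0 ≤ b := norm_nonneg _
  have h1 : ‖toL2 (matS N (curlS η))‖ ≤ 9 * ‖mulL N‖ * b := by
    have h2 : ‖toL2 (curlS η)‖ ≤ 9 * b := by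
      refine (norm_toL2_curlS_le η).trans ((Finset.sum_le_sum fun i _ => hη1 i).trans ?_)
      simp [b]; linarith
    calc _ ≤ ‖mulL N‖ * ‖toL2 (curlS η)‖ := norm_toL2_matS_le _ _
      _ ≤ ‖mulL N‖ * (9 * b) := by gcongr
      _ = _ := by ring
  have h2 : ‖toL2 (curlS (matS N η))‖ ≤ (9 * ‖mulL N‖ + 3 * D / κ) * b := by
    refine (norm_toL2_curlS_le _).trans ?_
    have : ∀ i ∈ Finset.univ, ‖toL2 (∂_{e3 i} (matS N η))‖ ≤
        ‖mulL ⇑(∂_{e3 i} N : 𝓢(R3, C3 →L[ℂ] C3))‖ * (3 / κ * b) + ‖mulL N‖ * (3 * b) := fun i _ => by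
      rw [lineDeriv_matS, map_add]
      refine (norm_add_le _ _).trans (add_le_add ?_ ?_)
      · exact (norm_toL2_matS_le _ _).trans (by gcongr)
      · exact (norm_toL2_matS_le _ _).trans (by gcongr; exact hη1 i)
    refine (Finset.sum_le_sum this).trans (le_of_eq ?_)
    rw [Finset.sum_add_distrib, ← Finset.sum_mul, ← hD]
    simp
    ring
  have h3 : ‖inner ℂ (toL2 η) (mulL X g)‖ ≤ 3 / κ * b * (‖mulL X‖ * ‖g‖) :=
    (norm_inner_le_norm _ _).trans
      (mul_le_mul hη0 (ContinuousLinearMap.le_opNorm _ _) (norm_nonneg _) (by positivity))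
  rw [← hη, map_add, map_smul, inner_add_left, inner_smul_left, hg.inner_curlS_curlS hX]
  have e : ‖(starRingEnd ℂ) ((κ : ℂ) ^ 2)‖ = κ ^ 2 := by simp
  calc _ ≤ ‖(starRingEnd ℂ) ((κ : ℂ) ^ 2) * inner ℂ (toL2 η) (mulL X g)‖
        + (‖k2 * inner ℂ (toL2 η) (mulL X g)‖ + ‖inner ℂ (toL2 (matS N (curlS η))) g‖
        + ‖inner ℂ (toL2 (curlS (matS N η))) g‖) := by
          refine (norm_add_le _ _).trans (add_le_add le_rfl ?_)
          exact (norm_sub_le _ _).trans (add_le_add (norm_sub_le _ _) le_rfl)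
    _ ≤ κ ^ 2 * (3 / κ * b * (‖mulL X‖ * ‖g‖)) + (κ ^ 2 * (3 / κ * b * (‖mulL X‖ * ‖g‖))
        + 9 * ‖mulL N‖ * b * ‖g‖ + (9 * ‖mulL N‖ + 3 * D / κ) * b * ‖g‖) := by
          rw [norm_mul, norm_mul, e]
          gcongr
          · exact (norm_inner_le_norm _ _).trans (by gcongr)
          · exact (norm_inner_le_norm _ _).trans (by gcongr)
    _ = (6 * ‖mulL X‖ + 18 * ‖mulL N‖ / κ + 3 * D / κ ^ 2) * κ * ‖g‖ * b := by
          field_simp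
          ring
    _ ≤ _ := by gcongr

/-- The cutoff vacuum field `χ g` solves the vacuum equation up to `∇ × p + r`, with sources `p`
of order zero and `r` of order one in `|k|`. Here `p` and `r` are, up to sign, the cross products of
`∇χ` with `g` and with the curl of `g`; a second cutoff `χ₁`, equal to `1` on the support of `χ`,
makes sense of the latter. -/
theorem IsVacuum.exists_isCurl_cutoff {Ω : Opens R3} {χ χ₁ : R3 → ℝ}
    {X X₁ : 𝓢(R3, C3 →L[ℂ] C3)} (hX : IsCutoff Ω χ X) (hX₁ : IsCutoff Ω χ₁ X₁)
    (h1 : ∀ x ∈ tsupport χ, χ₁ x = 1) {κ₀ : ℝ} (hκ₀ : 0 < κ₀) :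
    ∃ C : ℝ, 0 ≤ C ∧ ∀ κ : ℝ, κ₀ ≤ κ → ∀ k2 : ℂ, ‖k2‖ ≤ κ ^ 2 → ∀ g, IsVacuum Ω k2 g →
      ∃ c p r, IsCurl (mulL X g) c ∧ IsCurl (c + p) (k2 • mulL X g - r) ∧
        ‖c‖ ≤ C * κ * ‖g‖ ∧ ‖p‖ ≤ C * ‖g‖ ∧ ‖r‖ ≤ C * κ * ‖g‖ := by
  obtain ⟨C, hC, H⟩ := IsVacuum.exists_isCurl hX hκ₀
  obtain ⟨C₁, hC₁, H₁⟩ := IsVacuum.exists_isCurl hX₁ hκ₀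
  set N := crossGrad X
  refine ⟨C + ‖mulL N‖ + ‖mulL N‖ * C₁, by positivity, fun κ hκ k2 hk2 g hg => ?_⟩
  have hκ' : 0 < κ := hκ₀.trans_le hκ
  obtain ⟨c, hc, hcb⟩ := H κ hκ k2 hk2 g hg
  obtain ⟨c₁, hc₁, hcb₁⟩ := H₁ κ hκ k2 hk2 g hg
  refine ⟨c, (mulL N).adjoint g, (mulL N).adjoint c₁, hc, fun Ψ => ?_, ?_, ?_, ?_⟩
  · have hsub : Function.support N ⊆ tsupport χ :=
      (support_crossGrad_subset X).trans (closure_mono hX.support_subset)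
    -- the second cutoff is invisible on the support of `χ`
    have hcut : matS X₁ (curlS (matS N Ψ)) = curlS (matS N Ψ) := by
      ext1 x
      rw [matS_apply, hX₁.eq]
      by_cases hx : x ∈ tsupport χ
      · simp [scalarField, h1 x hx]
      · have : curlS (matS N Ψ) x = 0 := by
          by_contra h
          exact hx (closure_minimal ((support_matS_subset N Ψ).trans hsub) (isClosed_tsupport _)
            (support_curlS_subset _ h))
        simp [this]
    have e1 : inner ℂ (toL2 (curlS Ψ)) c = inner ℂ (toL2 (curlS (curlS Ψ))) (mulL X g) :=
      (hc (curlS Ψ)).symm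
    have e2 : inner ℂ (toL2 (curlS (matS N Ψ))) g = inner ℂ (toL2 (matS N Ψ)) c₁ := by
      rw [← hcut, ← hX₁.inner_mulL, hc₁]
    rw [inner_add_right, inner_sub_right, inner_smul_right, e1, hg.inner_curlS_curlS hX,
      ContinuousLinearMap.adjoint_inner_right, ContinuousLinearMap.adjoint_inner_right,
      ← toL2_matS, ← toL2_matS, e2]
    ring
  · refine hcb.trans ?_
    gcongr
    nlinarith [norm_nonneg (mulL N), mul_nonneg (norm_nonneg (mulL N)) hC₁]
  · refine ((mulL N).adjoint.le_opNorm g).trans ?_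
    rw [LinearIsometryEquiv.norm_map]
    gcongr
    nlinarith [norm_nonneg (mulL N), mul_nonneg (norm_nonneg (mulL N)) hC₁]
  · refine ((mulL N).adjoint.le_opNorm c₁).trans ?_
    rw [LinearIsometryEquiv.norm_map]
    calc _ ≤ ‖mulL N‖ * (C₁ * κ * ‖g‖) := by gcongr
      _ = ‖mulL N‖ * C₁ * κ * ‖g‖ := by ring
      _ ≤ _ := by
        gcongr
        nlinarith [norm_nonneg (mulL N), mul_nonneg (norm_nonneg (mulL N)) hC₁]

/-! ### Test fields and Schwartz fields -/

/-- Componentwise complex conjugation on `ℂ³`. -/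
noncomputable def conj3 : C3 →L[ℝ] C3 :=
  LinearMap.toContinuousLinearMap
    { toFun := fun a => WithLp.toLp 2 fun i => (starRingEnd ℂ) (a i)
      map_add' := fun a b => by ext i; simp
      map_smul' := fun c a => by ext i; simp }

@[simp] theorem conj3_apply (a : C3) (i : Fin 3) : conj3 a i = (starRingEnd ℂ) (a i) := rfl

@[simp] theorem conj3_conj3 (a : C3) : conj3 (conj3 a) = a := by ext i; simp

theorem dot3_conj3 (a b : C3) : dot3 a (conj3 b) = inner ℂ b a := by
  simp [dot3, PiLp.inner_apply]

theorem curl_conj3 {ψ : R3 → C3} (h : Differentiable ℝ ψ) (x : R3) :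
    curl (fun y => conj3 (ψ y)) x = conj3 (curl ψ x) := by
  have hp : ∀ i j, pd i j (fun y => conj3 (ψ y)) x = (starRingEnd ℂ) (pd i j ψ x) := fun i j => by
    have := (conj3.hasFDerivAt.comp x (h x).hasFDerivAt).fderiv
    have h2 : fderiv ℝ (fun y => conj3 (ψ y)) x = conj3.comp (fderiv ℝ ψ x) := this
    rw [pd, pd, h2]
    simp
  ext i
  fin_cases i <;> simp [curl, hp]

theorem curl_conj3_coe (Θ : 𝓢(R3, C3)) :
    curl (fun y => conj3 (Θ y)) = fun x => conj3 (curlS Θ x) := by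
  funext x
  rw [curl_conj3 Θ.differentiable, curlS_apply]

theorem curl_curl_conj3_coe (Θ : 𝓢(R3, C3)) :
    curl (curl fun y => conj3 (Θ y)) = fun x => conj3 (curlS (curlS Θ) x) := by
  rw [curl_conj3_coe, curl_conj3_coe]

/-- The complex conjugate of a compactly supported Schwartz field, as a test field. -/
noncomputable def conjTest {U : Opens R3} (Θ : 𝓢(R3, C3)) (h : HasCompactSupport Θ)
    (hU : tsupport Θ ⊆ U) : 𝓓(U, C3) where
  toFun x := conj3 (Θ x)
  contDiff' := conj3.contDiff.comp (Θ.smooth ⊤)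
  hasCompactSupport' := h.comp_left (map_zero conj3)
  tsupport_subset' := (closure_mono (Function.support_comp_subset (map_zero conj3) Θ)).trans hU

/-- The complex conjugate of a test field, as a Schwartz field. -/
noncomputable def conjSchwartz {U : Opens R3} (ψ : 𝓓(U, C3)) : 𝓢(R3, C3) :=
  HasCompactSupport.toSchwartzMap (f := fun x => conj3 (ψ x))
    (ψ.hasCompactSupport.comp_left (map_zero conj3)) (conj3.contDiff.comp ψ.contDiff)

theorem conjSchwartz_apply {U : Opens R3} (ψ : 𝓓(U, C3)) (x : R3) :
    conjSchwartz ψ x = conj3 (ψ x) := rfl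

theorem conj3_conjSchwartz {U : Opens R3} (ψ : 𝓓(U, C3)) :
    (fun x => conj3 (conjSchwartz ψ x)) = ψ := by
  funext x
  rw [conjSchwartz_apply, conj3_conj3]

/-- The bilinear pairing with a conjugated field is the Hermitian pairing of `L²`. -/
theorem integral_dot3_conj3 (u : L2R3) (Θ : 𝓢(R3, C3)) :
    ∫ x, dot3 (u x) (conj3 (Θ x)) = inner ℂ (toL2 Θ) u := by
  rw [L2.inner_def]
  refine integral_congr_ae ?_
  filter_upwards [coeFn_toL2 Θ] with x hx
  rw [hx, dot3_conj3]

theorem integral_dot3_coe {U : Opens R3} (u : L2R3) (ψ : 𝓓(U, C3)) :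
    ∫ x, dot3 (u x) (ψ x) = inner ℂ (toL2 (conjSchwartz ψ)) u := by
  rw [← integral_dot3_conj3]
  simp [conjSchwartz_apply]

theorem integral_dot3_curl {U : Opens R3} (u : L2R3) (ψ : 𝓓(U, C3)) :
    ∫ x, dot3 (u x) (curl ψ x) = inner ℂ (toL2 (curlS (conjSchwartz ψ))) u := by
  have h := curl_conj3_coe (conjSchwartz ψ)
  rw [conj3_conjSchwartz] at h
  rw [← integral_dot3_conj3, h]

theorem integral_dot3_curl_curl {U : Opens R3} (u : L2R3) (ψ : 𝓓(U, C3)) :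
    ∫ x, dot3 (u x) (curl (curl ψ) x) =
      inner ℂ (toL2 (curlS (curlS (conjSchwartz ψ)))) u := by
  have h := curl_curl_conj3_coe (conjSchwartz ψ)
  rw [conj3_conjSchwartz] at h
  rw [← integral_dot3_conj3, h]

theorem conjSchwartz_conjTest {U : Opens R3} (Θ : 𝓢(R3, C3)) (h : HasCompactSupport Θ)
    (hU : tsupport Θ ⊆ U) : conjSchwartz (conjTest Θ h hU) = Θ := by
  ext1 x
  exact conj3_conj3 (Θ x)

/-- The Schwartz matrix field `χ I` of a smooth compactly supported function `χ`. -/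
noncomputable def cutoffS (χ : R3 → ℝ) (h : ContDiff ℝ ∞ χ) (hs : HasCompactSupport χ) :
    𝓢(R3, C3 →L[ℂ] C3) :=
  HasCompactSupport.toSchwartzMap (f := scalarField χ)
    (hs.comp_left (g := fun r : ℝ => (r : ℂ) • ContinuousLinearMap.id ℂ C3) (by ext; simp))
    ((Complex.ofRealCLM.contDiff.comp h).smul contDiff_const)

theorem cutoffS_apply (χ : R3 → ℝ) (h : ContDiff ℝ ∞ χ) (hs : HasCompactSupport χ) (x : R3) :
    cutoffS χ h hs x = scalarField χ x := rfl

theorem norm_crossGrad_cutoffS_le {χ : R3 → ℝ} (h : ContDiff ℝ ∞ χ) (hs : HasCompactSupport χ)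
    (x : R3) (a : C3) : ‖crossGrad (cutoffS χ h hs) x a‖ ≤ 3 * ‖fderiv ℝ χ x‖ * ‖a‖ := by
  have hd : ∀ i, ∂_{e3 i} (cutoffS χ h hs) x a = ((fderiv ℝ χ x (e3 i) : ℝ) : ℂ) • a := fun i => by
    have h1 : HasFDerivAt χ (fderiv ℝ χ x) x :=
      (h.differentiable (by simp) x).hasFDerivAt
    have h2 : HasFDerivAt (cutoffS χ h hs) _ x :=
      (Complex.ofRealCLM.hasFDerivAt.comp x h1).smul_const (ContinuousLinearMap.id ℂ C3)
    rw [SchwartzMap.lineDerivOp_apply_eq_fderiv, h2.fderiv]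
    simp
  rw [crossGrad_apply, _root_.sum_apply]
  refine (norm_sum_le _ _).trans ?_
  have : ∀ i ∈ Finset.univ, ‖(crossE i).comp (∂_{e3 i} (cutoffS χ h hs) x) a‖ ≤
      ‖fderiv ℝ χ x‖ * ‖a‖ := fun i _ => by
    rw [ContinuousLinearMap.comp_apply, hd]
    refine (norm_crossE_apply_le _ _).trans ?_
    rw [norm_smul, Complex.norm_real]
    gcongr
    simpa using (fderiv ℝ χ x).le_opNorm (e3 i)
  refine (Finset.sum_le_sum this).trans ?_
  simp
  linarith

/-- Weak curls, defined by smooth compactly supported test fields, may be tested against Schwartz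
fields: the cutoffs `χ(x / n) Ψ` converge to `Ψ` together with their curls. -/
theorem IsWeakCurl.isCurl {u c : L2R3} (h : IsWeakCurl ⊤ u c) : IsCurl u c := by
  have hcpt : ∀ Θ : 𝓢(R3, C3), HasCompactSupport Θ →
      inner ℂ (toL2 (curlS Θ)) u = inner ℂ (toL2 Θ) c := fun Θ hΘ => by
    have hU : tsupport Θ ⊆ ((⊤ : Opens R3) : Set R3) := fun _ _ => trivial
    have := h (conjTest Θ hΘ hU)
    rwa [integral_dot3_curl, integral_dot3_coe, conjSchwartz_conjTest] at this
  intro Ψ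
  let f : ContDiffBump (0 : R3) := ⟨1, 2, one_pos, one_lt_two⟩
  let χ : ℕ → R3 → ℝ := fun n x => f (((n : ℝ) + 1)⁻¹ • x)
  have hn : ∀ n : ℕ, (0 : ℝ) < (n : ℝ) + 1 := fun n => by positivity
  have hχ : ∀ n, ContDiff ℝ ∞ (χ n) := fun n => f.contDiff.comp (contDiff_const_smul _)
  have hχs : ∀ n, HasCompactSupport (χ n) := fun n =>
    f.hasCompactSupport.comp_smul (inv_ne_zero (hn n).ne')
  have hχ1 : ∀ (n : ℕ) (x : R3), ‖x‖ < (n : ℝ) + 1 → χ n x = 1 := fun n x hx => by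
    refine f.one_of_mem_closedBall ?_
    rw [mem_closedBall_zero_iff, norm_smul, norm_inv, Real.norm_of_nonneg (hn n).le,
      inv_mul_le_iff₀ (hn n), show f.rIn = 1 from rfl, mul_one]
    exact hx.le
  obtain ⟨C, hC⟩ : ∃ C, ∀ x, ‖fderiv ℝ f x‖ ≤ C :=
    ((f.contDiff (n := 1)).continuous_fderiv one_ne_zero).bounded_above_of_compact_support
      (f.hasCompactSupport.fderiv (𝕜 := ℝ))
  have hC0 : 0 ≤ C := (norm_nonneg _).trans (hC 0)
  have hχd : ∀ n x, ‖fderiv ℝ (χ n) x‖ ≤ C := fun n x => by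
    have h1 : fderiv ℝ (χ n) x = ((n : ℝ) + 1)⁻¹ • fderiv ℝ f (((n : ℝ) + 1)⁻¹ • x) :=
      fderiv_comp_smul _
    rw [h1, norm_smul, norm_inv, Real.norm_of_nonneg (hn n).le]
    have : ((n : ℝ) + 1)⁻¹ ≤ 1 := inv_le_one_of_one_le₀ (by linarith [(n.cast_nonneg : (0:ℝ) ≤ n)])
    calc _ ≤ 1 * C := by
          gcongr
          exact hC _
      _ = C := one_mul C
  let X : ℕ → 𝓢(R3, C3 →L[ℂ] C3) := fun n => cutoffS (χ n) (hχ n) (hχs n)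
  let Θ : ℕ → 𝓢(R3, C3) := fun n => matS (X n) Ψ
  have hΘ : ∀ n x, Θ n x = (χ n x : ℂ) • Ψ x := fun n x => by
    simp [Θ, X, cutoffS_apply, scalarField]
  have hΘs : ∀ n, HasCompactSupport (Θ n) := fun n => (hχs n).mono fun x hx => by
    contrapose! hx
    simp only [Function.mem_support, not_not] at hx ⊢
    simp [hΘ, hx]
  have hcurl : ∀ n x, curlS (Θ n) x = (χ n x : ℂ) • curlS Ψ x + crossGrad (X n) x (Ψ x) :=
    fun n x => by
    rw [curlS_matS (cutoffS_apply (χ n) (hχ n) (hχs n))]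
    simp [X, cutoffS_apply, scalarField]
  have hχle : ∀ n x, ‖(χ n x : ℂ)‖ ≤ 1 := fun n x => by
    rw [Complex.norm_real, Real.norm_of_nonneg f.nonneg]
    exact f.le_one
  have hev : ∀ x : R3, ∀ᶠ n : ℕ in Filter.atTop, ‖x‖ < (n : ℝ) + 1 := fun x => by
    obtain ⟨N, hN⟩ := exists_nat_gt ‖x‖
    filter_upwards [Filter.eventually_ge_atTop N] with n hn'
    have : (N : ℝ) ≤ n := by exact_mod_cast hn'
    linarith
  have hlim1 : Filter.Tendsto (fun n => inner ℂ (toL2 (curlS (Θ n))) u) Filter.atTop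
      (nhds (inner ℂ (toL2 (curlS Ψ)) u)) := by
    simp only [← integral_dot3_conj3]
    refine tendsto_integral_of_dominated_convergence
      (fun x => ‖toL2 (curlS Ψ) x‖ * ‖u x‖ + 3 * C * (‖toL2 Ψ x‖ * ‖u x‖)) (fun n => ?_) ?_
      (fun n => ?_) ?_
    · simp only [dot3_conj3]
      exact ((curlS (Θ n)).continuous.aestronglyMeasurable).inner (Lp.aestronglyMeasurable u)
    · have hi : ∀ v : L2R3, Integrable fun x => ‖v x‖ * ‖u x‖ := fun v =>
        (Lp.memLp v).norm.integrable_mul (Lp.memLp u).norm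
      exact (hi _).add ((hi _).const_mul _)
    · filter_upwards [coeFn_toL2 (curlS Ψ), coeFn_toL2 Ψ] with x h1 h2
      rw [h1, h2, dot3_conj3, hcurl]
      refine (norm_inner_le_norm _ _).trans ?_
      have h3 : ‖(χ n x : ℂ) • curlS Ψ x + crossGrad (X n) x (Ψ x)‖ ≤
          1 * ‖curlS Ψ x‖ + 3 * C * ‖Ψ x‖ := by
        refine (norm_add_le _ _).trans (add_le_add ?_ ?_)
        · rw [norm_smul]
          gcongr
          exact hχle n x
        · refine (norm_crossGrad_cutoffS_le (hχ n) (hχs n) x (Ψ x)).trans ?_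
          gcongr
          exact hχd n x
      calc _ ≤ (1 * ‖curlS Ψ x‖ + 3 * C * ‖Ψ x‖) * ‖u x‖ := by gcongr
        _ = _ := by ring
    · refine Filter.Eventually.of_forall fun x => tendsto_const_nhds.congr' ?_
      filter_upwards [hev x] with n hx
      have hloc : (Θ n : R3 → C3) =ᶠ[nhds x] Ψ := by
        filter_upwards [(isOpen_lt continuous_norm continuous_const).mem_nhds hx] with y hy
        simp [hΘ, hχ1 n y hy]
      rw [curlS_apply, curlS_apply, curl_eq_sum_crossE, curl_eq_sum_crossE, hloc.fderiv_eq]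
  have hlim2 : Filter.Tendsto (fun n => inner ℂ (toL2 (Θ n)) c) Filter.atTop
      (nhds (inner ℂ (toL2 Ψ) c)) := by
    simp only [← integral_dot3_conj3]
    refine tendsto_integral_of_dominated_convergence
      (fun x => ‖toL2 Ψ x‖ * ‖c x‖) (fun n => ?_) ?_ (fun n => ?_) ?_
    · simp only [dot3_conj3]
      exact ((Θ n).continuous.aestronglyMeasurable).inner (Lp.aestronglyMeasurable c)
    · exact (Lp.memLp (toL2 Ψ)).norm.integrable_mul (Lp.memLp c).norm
    · filter_upwards [coeFn_toL2 Ψ] with x h2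
      rw [h2, dot3_conj3, hΘ]
      refine (norm_inner_le_norm _ _).trans ?_
      rw [norm_smul]
      calc _ ≤ 1 * ‖Ψ x‖ * ‖c x‖ := by
            gcongr
            exact hχle n x
        _ = _ := by ring
    · refine Filter.Eventually.of_forall fun x => tendsto_const_nhds.congr' ?_
      filter_upwards [hev x] with n hx
      simp [hΘ, hχ1 n x hx]
  exact tendsto_nhds_unique hlim1 (hlim2.congr fun n => (hcpt (Θ n) (hΘs n)).symm)

theorem isWeakCurl_iff {u c : L2R3} : IsWeakCurl ⊤ u c ↔ IsCurl u c := by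
  refine ⟨IsWeakCurl.isCurl, fun h ψ => ?_⟩
  rw [integral_dot3_curl, integral_dot3_coe, h]

theorem HCurl.isCurl (u : HCurl) : IsCurl (HCurl.field u) (HCurl.curl u) :=
  IsWeakCurl.isCurl u.2

/-- Around a compact subset of an open set there is a smooth cutoff. -/
theorem exists_isCutoff {Ω : Opens R3} {K : Set R3} (hK : IsCompact K) (hKΩ : K ⊆ Ω) :
    ∃ χ X, IsCutoff Ω χ X ∧ ∀ x ∈ K, χ x = 1 := by
  obtain ⟨L, hL, hKL, hLΩ⟩ := exists_compact_between hK Ω.isOpen hKΩ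
  obtain ⟨f, hf0, hf1, -⟩ := exists_contMDiffMap_zero_one_of_isClosed (modelWithCornersSelf ℝ R3)
    (n := (⊤ : ℕ∞)) (s := (interior L)ᶜ) (t := K) isOpen_interior.isClosed_compl hK.isClosed
    (Set.disjoint_left.2 fun x hx hx' => hx (hKL hx'))
  have hfc : ContDiff ℝ ∞ f := f.contMDiff.contDiff
  have hsupp : tsupport f ⊆ L := by
    refine closure_minimal (fun x hx => ?_) hL.isClosed
    by_contra hxL
    exact hx (hf0 fun h => hxL (interior_subset h))
  have hs : HasCompactSupport f := hL.of_isClosed_subset (isClosed_tsupport _) hsupp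
  refine ⟨f, cutoffS f hfc hs, ⟨cutoffS_apply f hfc hs, hs, hsupp.trans hLΩ, ?_⟩, fun x hx => hf1 hx⟩
  exact hfc.continuous.memLp_top_of_hasCompactSupport hs _

/-! ### The medium as a bounded operator -/

theorem IsMedium.memLp {Ω : Opens R3} {ε₀ : ℝ} {ε : R3 → ℝ} (hε : IsMedium Ω ε₀ ε) :
    MemLp ε ∞ (volume : Measure R3) := by
  obtain ⟨a, b, ha, h⟩ := hε.bounds
  refine memLp_top_of_bound hε.aemeasurable.aestronglyMeasurable b ?_
  filter_upwards [h] with x hx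
  rw [Real.norm_of_nonneg (ha.le.trans hx.1)]
  exact hx.2

theorem IsMedium.memLp_sub {Ω : Opens R3} {ε₀ : ℝ} {ε : R3 → ℝ} (hε : IsMedium Ω ε₀ ε) :
    MemLp (fun x => ε x - ε₀) ∞ (volume : Measure R3) :=
  hε.memLp.sub (memLp_top_const ε₀)

theorem inner_mulL_scalarField_self {a : R3 → ℝ} (ha : MemLp a ∞ (volume : Measure R3)) (u : L2R3) :
    inner ℂ u (mulL (scalarField a) u) = ((∫ x, a x * ‖u x‖ ^ 2 : ℝ) : ℂ) := by
  rw [L2.inner_def, ← integral_complex_ofReal]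
  refine integral_congr_ae ?_
  filter_upwards [mulL_scalarField_coeFn ha u] with x h
  rw [h, inner_smul_right, inner_self_eq_norm_sq_to_K]
  push_cast
  rfl

theorem norm_sq_L2R3 (u : L2R3) : ‖u‖ ^ 2 = ∫ x, ‖u x‖ ^ 2 := by
  have h := L2.inner_def (𝕜 := ℂ) u u
  rw [inner_self_eq_norm_sq_to_K] at h
  have h2 : ∫ x, inner ℂ (u x) (u x) = ((∫ x, ‖u x‖ ^ 2 : ℝ) : ℂ) := by
    rw [← integral_complex_ofReal]
    refine integral_congr_ae (Filter.Eventually.of_forall fun x => ?_)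
    simp only [inner_self_eq_norm_sq_to_K]
    push_cast
    rfl
  rw [h2] at h
  exact Complex.ofReal_injective (by simpa using h)

theorem integrable_norm_sq (u : L2R3) : Integrable fun x => ‖u x‖ ^ 2 :=
  (Lp.memLp u).norm.integrable_sq

/-- The electric energy is bounded below by the square norm of the field. -/
theorem IsMedium.exists_le_re_inner {Ω : Opens R3} {ε₀ : ℝ} {ε : R3 → ℝ} (hε : IsMedium Ω ε₀ ε) :
    ∃ a > 0, ∀ u : L2R3, ∃ s : ℝ, a * ‖u‖ ^ 2 ≤ s ∧
      inner ℂ u (mulL (scalarField ε) u) = (s : ℂ) := by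
  obtain ⟨a, b, ha, h⟩ := hε.bounds
  refine ⟨a, ha, fun u => ⟨_, ?_, inner_mulL_scalarField_self hε.memLp u⟩⟩
  rw [norm_sq_L2R3, ← integral_const_mul]
  have hi : Integrable fun x => ε x * ‖u x‖ ^ 2 := by
    refine (integrable_norm_sq u).bdd_mul (c := b) hε.aemeasurable.aestronglyMeasurable ?_
    filter_upwards [h] with x hx
    rw [Real.norm_of_nonneg (ha.le.trans hx.1)]
    exact hx.2
  refine integral_mono_ae ((integrable_norm_sq u).const_mul a) hi ?_
  filter_upwards [h] with x hx
  exact mul_le_mul_of_nonneg_right hx.1 (by positivity)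

/-- The contrast `ε - ε₀` is not affected by a cutoff which is `1` on its support. -/
theorem IsMedium.mulL_cutoff {Ω : Opens R3} {ε₀ : ℝ} {ε : R3 → ℝ} (hε : IsMedium Ω ε₀ ε)
    {K : Set R3} (hK : ∀ᵐ x : R3, x ∉ K → ε x = ε₀) {χ : R3 → ℝ} {X : 𝓢(R3, C3 →L[ℂ] C3)}
    (hX : IsCutoff Ω χ X) (h1 : ∀ x ∈ K, χ x = 1) (g : L2R3) :
    mulL (scalarField ε) (mulL X g) =
      (ε₀ : ℂ) • mulL X g + mulL (scalarField fun x => ε x - ε₀) g := by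
  rw [hX.mulL_eq]
  refine Lp.ext ?_
  filter_upwards [hK, mulL_scalarField_coeFn hε.memLp (mulL (scalarField χ) g),
    mulL_scalarField_coeFn hX.memLp g, mulL_scalarField_coeFn hε.memLp_sub g,
    Lp.coeFn_add ((ε₀ : ℂ) • mulL (scalarField χ) g) (mulL (scalarField fun x => ε x - ε₀) g),
    Lp.coeFn_smul (ε₀ : ℂ) (mulL (scalarField χ) g)] with x hx e1 e2 e3 e4 e5
  rw [e1, e4, Pi.add_apply, e5, Pi.smul_apply, e2, e3]
  by_cases hxK : x ∈ K
  · simp [h1 x hxK, sub_smul]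
  · simp [hx hxK]

theorem memLp_indicator_L2On {Ω : Opens R3} (f : L2On Ω) :
    MemLp ((Ω : Set R3).indicator f) 2 (volume : Measure R3) :=
  (memLp_indicator_iff_restrict Ω.isOpen.measurableSet).2 (Lp.memLp f)

/-- Extension of a field on `Ω` by zero, as a linear map. -/
noncomputable def ext0ₗ (Ω : Opens R3) : L2On Ω →ₗ[ℂ] L2R3 where
  toFun f := (memLp_indicator_L2On f).toLp
  map_add' f g := by
    rw [← MemLp.toLp_add]
    refine MemLp.toLp_congr _ _ ?_
    have h := (ae_restrict_iff' Ω.isOpen.measurableSet).1 (Lp.coeFn_add f g)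
    filter_upwards [h] with x hx
    by_cases hxΩ : x ∈ (Ω : Set R3)
    · simpa [hxΩ] using hx hxΩ
    · simp [hxΩ]
  map_smul' c f := by
    rw [RingHom.id_apply, ← MemLp.toLp_const_smul]
    refine MemLp.toLp_congr _ _ ?_
    have h := (ae_restrict_iff' Ω.isOpen.measurableSet).1 (Lp.coeFn_smul c f)
    filter_upwards [h] with x hx
    by_cases hxΩ : x ∈ (Ω : Set R3)
    · simpa [hxΩ] using hx hxΩ
    · simp [hxΩ]

theorem norm_ext0ₗ {Ω : Opens R3} (f : L2On Ω) : ‖ext0ₗ Ω f‖ = ‖f‖ := by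
  have h : ‖ext0ₗ Ω f‖ = ‖(memLp_indicator_L2On f).toLp‖ := rfl
  rw [h, Lp.norm_toLp, eLpNorm_indicator_eq_eLpNorm_restrict Ω.isOpen.measurableSet, Lp.norm_def]

/-- Extension of a field on `Ω` by zero. -/
noncomputable def ext0 (Ω : Opens R3) : L2On Ω →L[ℂ] L2R3 :=
  (ext0ₗ Ω).mkContinuous 1 fun f => by rw [norm_ext0ₗ, one_mul]

theorem norm_ext0 {Ω : Opens R3} (f : L2On Ω) : ‖ext0 Ω f‖ = ‖f‖ := norm_ext0ₗ f

theorem ext0_coeFn {Ω : Opens R3} (f : L2On Ω) :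
    ext0 Ω f =ᵐ[volume] (Ω : Set R3).indicator f := by
  have h : ext0 Ω f = (memLp_indicator_L2On f).toLp := rfl
  rw [h]
  exact (memLp_indicator_L2On f).coeFn_toLp

theorem setIntegral_dot3 {Ω : Opens R3} (f : L2On Ω) {φ : R3 → C3} :
    ∫ x in (Ω : Set R3), dot3 (f x) (φ x) = ∫ x, dot3 (ext0 Ω f x) (φ x) := by
  rw [← integral_indicator Ω.isOpen.measurableSet]
  refine integral_congr_ae ?_
  filter_upwards [ext0_coeFn f] with x hx
  rw [hx]
  by_cases hxΩ : x ∈ (Ω : Set R3)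
  · simp [hxΩ]
  · simp [hxΩ, dot3]

/-! ### The variational problem at a fixed frequency -/

/-- The continuous inclusion of `H(curl, ℝ³)` in `(L²(ℝ³))³`. -/
noncomputable def fieldL : HCurl →L[ℂ] L2R3 := (WithLp.fstL 2 ℂ L2R3 L2R3).comp HCurl.subtypeL

/-- The curl as a bounded operator on `H(curl, ℝ³)`. -/
noncomputable def curlL : HCurl →L[ℂ] L2R3 := (WithLp.sndL 2 ℂ L2R3 L2R3).comp HCurl.subtypeL

theorem fieldL_apply (u : HCurl) : fieldL u = HCurl.field u := rfl

theorem curlL_apply (u : HCurl) : curlL u = HCurl.curl u := rfl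

theorem isCurl_fieldL (u : HCurl) : IsCurl (fieldL u) (curlL u) := HCurl.isCurl u

theorem norm_sq_HCurl (u : HCurl) : ‖u‖ ^ 2 = ‖fieldL u‖ ^ 2 + ‖curlL u‖ ^ 2 :=
  WithLp.prod_norm_sq_eq_of_L2 (u : WithLp 2 (L2R3 × L2R3))

theorem norm_HCurl_le (u : HCurl) : ‖u‖ ≤ ‖fieldL u‖ + ‖curlL u‖ := by
  refine abs_le_of_sq_le_sq' ?_ (by positivity) |>.2
  rw [norm_sq_HCurl]
  nlinarith [norm_nonneg (fieldL u), norm_nonneg (curlL u)]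

/-- The element of `H(curl, ℝ³)` given by a field with a weak curl in `L²`. -/
noncomputable def IsCurl.toHCurl {u c : L2R3} (h : IsCurl u c) : HCurl :=
  ⟨WithLp.toLp 2 (u, c), isWeakCurl_iff.2 h⟩

@[simp] theorem IsCurl.fieldL_toHCurl {u c : L2R3} (h : IsCurl u c) : fieldL h.toHCurl = u := rfl

@[simp] theorem IsCurl.curlL_toHCurl {u c : L2R3} (h : IsCurl u c) : curlL h.toHCurl = c := rfl

theorem HCurl.ext_field {u v : HCurl} (h : fieldL u = fieldL v) : u = v := by
  have hc : curlL u = curlL v := (isCurl_fieldL u).unique (h ▸ isCurl_fieldL v)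
  refine Subtype.ext ?_
  have h1 : (u : WithLp 2 (L2R3 × L2R3)).fst = (v : WithLp 2 (L2R3 × L2R3)).fst := h
  have h2 : (u : WithLp 2 (L2R3 × L2R3)).snd = (v : WithLp 2 (L2R3 × L2R3)).snd := hc
  exact (WithLp.ofLp_injective 2) (Prod.ext h1 h2)

open ContinuousLinearMap in
/-- The operator on `H(curl, ℝ³)` of the sesquilinear form
`(v, u) ↦ ⟪∇ × v, ∇ × u⟫ - w² μ₀ ⟪v, ε u⟫`. -/
noncomputable def waveOp (μ₀ : ℝ) (ε : R3 → ℝ) (w : ℂ) : HCurl →L[ℂ] HCurl :=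
  (adjoint curlL).comp curlL -
    (w ^ 2 * μ₀) • (adjoint fieldL).comp ((mulL (scalarField ε)).comp fieldL)

theorem inner_waveOp (μ₀ : ℝ) (ε : R3 → ℝ) (w : ℂ) (v u : HCurl) :
    inner ℂ v (waveOp μ₀ ε w u) = inner ℂ (curlL v) (curlL u) -
      w ^ 2 * μ₀ * inner ℂ (fieldL v) (mulL (scalarField ε) (fieldL u)) := by
  simp [waveOp, ContinuousLinearMap.adjoint_inner_right]

/-- Rotating by `i w̄` makes both terms of `q - w² s` contribute with the positive real
part `Im w`. -/
theorem im_mul_le_norm_mul (w : ℂ) (q s : ℝ) :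
    w.im * (q + ‖w‖ ^ 2 * s) ≤ ‖w‖ * ‖(q : ℂ) - w ^ 2 * s‖ := by
  have h : (Complex.I * (starRingEnd ℂ) w * ((q : ℂ) - w ^ 2 * s)).re =
      w.im * (q + ‖w‖ ^ 2 * s) := by
    have : ‖w‖ ^ 2 = w.re * w.re + w.im * w.im := by
      rw [Complex.sq_norm, Complex.normSq_apply]
    rw [this]
    simp [pow_two]
    ring
  rw [← h]
  refine (Complex.re_le_norm _).trans (le_of_eq ?_)
  simp

/-- The coercivity estimate, with its dependence on the frequency. -/
theorem im_mul_le_norm_inner_waveOp {μ₀ : ℝ} (hμ₀ : 0 < μ₀) {ε : R3 → ℝ} {a : ℝ}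
    (ha : ∀ u : L2R3, ∃ s : ℝ, a * ‖u‖ ^ 2 ≤ s ∧ inner ℂ u (mulL (scalarField ε) u) = (s : ℂ))
    {w : ℂ} (hw : 0 < w.im) (u : HCurl) :
    w.im * (‖curlL u‖ ^ 2 + ‖w‖ ^ 2 * (μ₀ * a * ‖fieldL u‖ ^ 2)) ≤
      ‖w‖ * ‖inner ℂ u (waveOp μ₀ ε w u)‖ := by
  obtain ⟨s, hs, hs'⟩ := ha (fieldL u)
  have h := im_mul_le_norm_mul w (‖curlL u‖ ^ 2) (μ₀ * s)
  rw [inner_waveOp, hs', inner_self_eq_norm_sq_to_K]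
  have e : (((‖curlL u‖ ^ 2 : ℝ) : ℂ) - w ^ 2 * ((μ₀ * s : ℝ) : ℂ)) =
      (‖curlL u‖ : ℂ) ^ 2 - w ^ 2 * μ₀ * s := by
    push_cast
    ring
  rw [e] at h
  refine le_trans ?_ h
  have : μ₀ * a * ‖fieldL u‖ ^ 2 ≤ μ₀ * s := by
    rw [mul_assoc]
    gcongr
  gcongr

/-- In the upper half plane the form of `waveOp` is coercive, hence Lax-Milgram applies. -/
theorem isUnit_waveOp {Ω : Opens R3} {ε₀ μ₀ : ℝ} (hμ₀ : 0 < μ₀) {ε : R3 → ℝ}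
    (hε : IsMedium Ω ε₀ ε) {w : ℂ} (hw : 0 < w.im) : IsUnit (waveOp μ₀ ε w) := by
  obtain ⟨a, ha, H⟩ := hε.exists_le_re_inner
  have hw' : 0 < ‖w‖ := hw.trans_le (Complex.im_le_norm w)
  set c : ℝ := w.im / ‖w‖ * min 1 (‖w‖ ^ 2 * (μ₀ * a))
  have hc : 0 < c := by positivity
  refine ContinuousLinearMap.isUnit_of_forall_le_norm_inner_map _ (c := ⟨c, hc.le⟩) hc fun u => ?_
  have h := im_mul_le_norm_inner_waveOp hμ₀ H hw u
  rw [norm_inner_symm]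
  have h1 : min 1 (‖w‖ ^ 2 * (μ₀ * a)) * ‖u‖ ^ 2 ≤
      ‖curlL u‖ ^ 2 + ‖w‖ ^ 2 * (μ₀ * a * ‖fieldL u‖ ^ 2) := by
    rw [norm_sq_HCurl]
    have e1 := mul_le_mul_of_nonneg_right (min_le_left 1 (‖w‖ ^ 2 * (μ₀ * a)))
      (sq_nonneg ‖curlL u‖)
    have e2 := mul_le_mul_of_nonneg_right (min_le_right 1 (‖w‖ ^ 2 * (μ₀ * a)))
      (sq_nonneg ‖fieldL u‖)
    linarith
  have h2 : w.im * (min 1 (‖w‖ ^ 2 * (μ₀ * a)) * ‖u‖ ^ 2) ≤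
      ‖w‖ * ‖inner ℂ u (waveOp μ₀ ε w u)‖ := (mul_le_mul_of_nonneg_left h1 hw.le).trans h
  change ‖u‖ ^ 2 * c ≤ _
  rw [← div_le_iff₀' hw'] at h2
  refine le_trans (le_of_eq ?_) h2
  simp only [c]
  ring

open ContinuousLinearMap in
/-- The solution operator at the frequency `w`: it maps the incident field `g` to the scattered
field `u`, with `⟪∇ × v, ∇ × u⟫ - w² μ₀ ⟪v, ε u⟫ = w² μ₀ ⟪v, (ε - ε₀) g⟫` for all `v`. -/
noncomputable def solOp (ε₀ μ₀ : ℝ) (ε : R3 → ℝ) (w : ℂ) : L2R3 →L[ℂ] HCurl :=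
  (Ring.inverse (waveOp μ₀ ε w)).comp
    ((w ^ 2 * μ₀) • (adjoint fieldL).comp (mulL (scalarField fun x => ε x - ε₀)))

section Frequency

variable {Ω : Opens R3} {ε₀ μ₀ : ℝ} {ε : R3 → ℝ}

theorem continuousAt_solOp (hμ₀ : 0 < μ₀) (hε : IsMedium Ω ε₀ ε) {w : ℂ} (hw : 0 < w.im) :
    ContinuousAt (solOp ε₀ μ₀ ε) w := by
  have h1 : Continuous fun w => waveOp μ₀ ε w := by
    unfold waveOp
    fun_prop
  obtain ⟨U, hU⟩ := isUnit_waveOp hμ₀ hε hw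
  have h2 : ContinuousAt (fun w => Ring.inverse (waveOp μ₀ ε w)) w := by
    refine ContinuousAt.comp (g := Ring.inverse) ?_ h1.continuousAt
    rw [← hU]
    exact NormedRing.inverse_continuousAt (R := HCurl →L[ℂ] HCurl) U
  unfold solOp
  refine h2.clm_comp ?_
  fun_prop

/-- The variational equation for the scattered field. -/
theorem inner_waveOp_solOp (hμ₀ : 0 < μ₀) (hε : IsMedium Ω ε₀ ε) {w : ℂ} (hw : 0 < w.im)
    (g : L2R3) (v : HCurl) :
    inner ℂ v (waveOp μ₀ ε w (solOp ε₀ μ₀ ε w g)) =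
      w ^ 2 * μ₀ * inner ℂ (fieldL v) (mulL (scalarField fun x => ε x - ε₀) g) := by
  have h := Ring.mul_inverse_cancel _ (isUnit_waveOp hμ₀ hε hw)
  have h' : ∀ y, waveOp μ₀ ε w (Ring.inverse (waveOp μ₀ ε w) y) = y := fun y =>
    DFunLike.congr_fun h y
  rw [solOp, ContinuousLinearMap.comp_apply, h']
  simp [ContinuousLinearMap.adjoint_inner_right]

/-- The scattered field `u` at the frequency `w` satisfies
`∇ × ∇ × u = w² μ₀ (ε u + (ε - ε₀) g)`. -/
theorem isCurl_curlL_solOp (hμ₀ : 0 < μ₀) (hε : IsMedium Ω ε₀ ε) {w : ℂ} (hw : 0 < w.im)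
    (g : L2R3) :
    IsCurl (curlL (solOp ε₀ μ₀ ε w g)) ((w ^ 2 * μ₀) •
      (mulL (scalarField ε) (fieldL (solOp ε₀ μ₀ ε w g)) +
        mulL (scalarField fun x => ε x - ε₀) g)) := fun Ψ => by
  have h := inner_waveOp_solOp hμ₀ hε hw g (isCurl_toLp Ψ).toHCurl
  rw [inner_waveOp] at h
  simp only [IsCurl.fieldL_toHCurl, IsCurl.curlL_toHCurl] at h
  rw [inner_smul_right, inner_add_right, mul_add, ← h]
  ring

theorem add_le_of_sq_add_sq_le {x y δ W s : ℝ} (hx : 0 ≤ x) (hy : 0 ≤ y) (hδ : 0 < δ) (hW : 0 ≤ W)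
    (hs : 0 ≤ s) (h : δ * (x ^ 2 + y ^ 2) ≤ W * (x + s * y)) :
    x + y ≤ 2 * (1 + s) / δ * W := by
  have h1 : δ * (x + y) ^ 2 ≤ 2 * (1 + s) * W * (x + y) := by
    have h2 : W * (x + s * y) ≤ W * ((1 + s) * (x + y)) := by
      gcongr
      nlinarith
    nlinarith [mul_nonneg hδ.le (sq_nonneg (x - y))]
  rcases (add_nonneg hx hy).eq_or_lt with h0 | h0
  · rw [← h0]
    positivity
  · have h3 : δ * (x + y) ≤ 2 * (1 + s) * W := by
      refine le_of_mul_le_mul_right ?_ h0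
      linarith
    rw [div_mul_eq_mul_div, le_div_iff₀ hδ]
    linarith

/-- The frequency domain estimate: the scattered field is bounded in `H(curl)` by `|w|` times the
`L²` norm of the incident field, uniformly on the line `Im w = σ`. It rests on the fact that
near the support of `ε - ε₀` the total field is `u + χ g` with `χ g` in `H(curl)`, and that it
solves a problem whose source terms involve derivatives of `χ` only. -/
theorem exists_norm_solOp_le (hε₀ : 0 < ε₀) (hμ₀ : 0 < μ₀) (hε : IsMedium Ω ε₀ ε) {σ : ℝ}
    (hσ : 0 < σ) :
    ∃ C : ℝ, 0 < C ∧ ∀ w : ℂ, w.im = σ → ∀ g, IsVacuum Ω (ε₀ * μ₀ * w ^ 2) g →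
      ‖solOp ε₀ μ₀ ε w g‖ ≤ C * ‖w‖ * ‖g‖ := by
  obtain ⟨a, ha, Ha⟩ := hε.exists_le_re_inner
  obtain ⟨K, hK, hKΩ, hKε⟩ := hε.support
  obtain ⟨χ, X, hX, h1⟩ := exists_isCutoff hK hKΩ
  obtain ⟨χ₁, X₁, hX₁, h2⟩ := exists_isCutoff hX.hasCompactSupport hX.tsupport_subset
  set s : ℝ := Real.sqrt (ε₀ * μ₀)
  have hs : 0 < s := Real.sqrt_pos.2 (mul_pos hε₀ hμ₀)
  have hs2 : s ^ 2 = ε₀ * μ₀ := Real.sq_sqrt (mul_pos hε₀ hμ₀).le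
  obtain ⟨C, hC, H⟩ := IsVacuum.exists_isCurl_cutoff hX hX₁ h2 (mul_pos hσ hs)
  set δ : ℝ := σ * min 1 (μ₀ * a)
  have hδ : 0 < δ := by positivity
  set D : ℝ := 2 * (1 + s) / δ * C
  refine ⟨D * (1 + 1 / σ) + ‖mulL X‖ / σ + C * s + 1, by positivity, fun w hw g hg => ?_⟩
  have hwσ : σ ≤ ‖w‖ := hw ▸ Complex.im_le_norm w
  have hw0 : 0 < ‖w‖ := hσ.trans_le hwσ
  have hwi : 0 < w.im := hw ▸ hσ
  -- `κ² = |k²|` for the wave number `k² = ε₀ μ₀ w²` in the vacuum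
  set κ : ℝ := ‖w‖ * s
  have hk2 : ‖(ε₀ * μ₀ * w ^ 2 : ℂ)‖ ≤ κ ^ 2 := by
    rw [norm_mul, norm_mul, norm_pow, Complex.norm_real, Complex.norm_real,
      Real.norm_of_nonneg hε₀.le, Real.norm_of_nonneg hμ₀.le, ← hs2]
    exact le_of_eq (by ring)
  obtain ⟨c, p, r, hc, hp, hcb, hpb, hrb⟩ := H κ (mul_le_mul_of_nonneg_right hwσ hs.le) _ hk2 g hg
  set u := solOp ε₀ μ₀ ε w g
  -- the scattered field plus the cutoff incident field
  set U := u + hc.toHCurl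
  have hUf : fieldL U = fieldL u + mulL X g := by simp [U]
  have hUc : curlL U = curlL u + c := by simp [U]
  -- the equation for `U`, tested with `U` itself: the source `(ε - ε₀) g` has cancelled
  have hform : inner ℂ U (waveOp μ₀ ε w U) = - inner ℂ (curlL U) p - inner ℂ (fieldL U) r := by
    have e1 := inner_waveOp_solOp hμ₀ hε hwi g U
    have e2 := (isCurl_fieldL U).inner_comm hp
    have e3 := hε.mulL_cutoff hKε hX h1 g
    have e4 : inner ℂ U (waveOp μ₀ ε w U) =
        inner ℂ U (waveOp μ₀ ε w u) + inner ℂ U (waveOp μ₀ ε w hc.toHCurl) := by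
      have e5 : waveOp μ₀ ε w U = waveOp μ₀ ε w u + waveOp μ₀ ε w hc.toHCurl := map_add _ _ _
      rw [e5]
      exact inner_add_right U _ _
    rw [e4, e1, inner_waveOp, IsCurl.fieldL_toHCurl, IsCurl.curlL_toHCurl, e3]
    simp only [inner_add_right, inner_sub_right, inner_smul_right] at e2 ⊢
    linear_combination e2
  have hnorm := im_mul_le_norm_inner_waveOp hμ₀ Ha hwi U
  rw [hform, hw] at hnorm
  have hrhs : ‖- inner ℂ (curlL U) p - inner ℂ (fieldL U) r‖ ≤
      C * ‖g‖ * (‖curlL U‖ + s * (‖w‖ * ‖fieldL U‖)) := by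
    refine (norm_sub_le _ _).trans ?_
    rw [norm_neg]
    calc _ ≤ ‖curlL U‖ * ‖p‖ + ‖fieldL U‖ * ‖r‖ :=
          add_le_add (norm_inner_le_norm _ _) (norm_inner_le_norm _ _)
      _ ≤ ‖curlL U‖ * (C * ‖g‖) + ‖fieldL U‖ * (C * κ * ‖g‖) := by gcongr
      _ = _ := by
          simp only [κ]
          ring
  have hquad : δ * (‖curlL U‖ ^ 2 + (‖w‖ * ‖fieldL U‖) ^ 2) ≤
      (‖w‖ * (C * ‖g‖)) * (‖curlL U‖ + s * (‖w‖ * ‖fieldL U‖)) := by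
    refine le_trans ?_ (hnorm.trans (mul_le_mul_of_nonneg_left hrhs hw0.le) |>.trans_eq (by ring))
    have e1 := mul_le_mul_of_nonneg_right (min_le_left 1 (μ₀ * a)) (sq_nonneg ‖curlL U‖)
    have e2 := mul_le_mul_of_nonneg_right (min_le_right 1 (μ₀ * a))
      (sq_nonneg (‖w‖ * ‖fieldL U‖))
    simp only [δ]
    rw [mul_assoc]
    gcongr
    linarith
  have hbound := add_le_of_sq_add_sq_le (norm_nonneg _) (by positivity) hδ (by positivity) hs.le hquad
  have hbound' : ‖curlL U‖ + ‖w‖ * ‖fieldL U‖ ≤ D * ‖w‖ * ‖g‖ :=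
    hbound.trans_eq (by simp only [D]; ring)
  have hcU : ‖curlL U‖ ≤ D * ‖w‖ * ‖g‖ :=
    le_trans (le_add_of_nonneg_right (by positivity)) hbound'
  have hfU : ‖fieldL U‖ ≤ D / σ * ‖w‖ * ‖g‖ := by
    have : σ * ‖fieldL U‖ ≤ D * ‖w‖ * ‖g‖ :=
      le_trans ((mul_le_mul_of_nonneg_right hwσ (norm_nonneg _)).trans
        (le_add_of_nonneg_left (norm_nonneg _))) hbound'
    rw [div_mul_eq_mul_div, div_mul_eq_mul_div, le_div_iff₀ hσ]
    linarith
  have hfu : ‖fieldL u‖ ≤ D / σ * ‖w‖ * ‖g‖ + ‖mulL X‖ / σ * ‖w‖ * ‖g‖ := by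
    have e : fieldL u = fieldL U - mulL X g := by rw [hUf, add_sub_cancel_right]
    rw [e]
    refine (norm_sub_le _ _).trans (add_le_add hfU (((mulL X).le_opNorm g).trans ?_))
    have : 1 ≤ ‖w‖ / σ := by rwa [le_div_iff₀ hσ, one_mul]
    calc ‖mulL X‖ * ‖g‖ = ‖mulL X‖ * 1 * ‖g‖ := by ring
      _ ≤ ‖mulL X‖ * (‖w‖ / σ) * ‖g‖ := by gcongr
      _ = _ := by ring
  have hcu : ‖curlL u‖ ≤ D * ‖w‖ * ‖g‖ + C * s * ‖w‖ * ‖g‖ := by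
    have e : curlL u = curlL U - c := by rw [hUc, add_sub_cancel_right]
    rw [e]
    refine (norm_sub_le _ _).trans (add_le_add hcU (hcb.trans_eq ?_))
    simp only [κ]
    ring
  refine (norm_HCurl_le u).trans ((add_le_add hfu hcu).trans ?_)
  have : 0 ≤ ‖w‖ * ‖g‖ := by positivity
  calc _ = (D * (1 + 1 / σ) + ‖mulL X‖ / σ + C * s) * (‖w‖ * ‖g‖) := by ring
    _ ≤ (D * (1 + 1 / σ) + ‖mulL X‖ / σ + C * s + 1) * (‖w‖ * ‖g‖) :=
        mul_le_mul_of_nonneg_right (by linarith) this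
    _ = _ := by ring

end Frequency

/-! ### Test functions on the line and their Laplace transforms -/

/-- Test functions of time. -/
abbrev TestFn : Type := 𝓓((⊤ : Opens ℝ), ℝ)

/-- The point `ξ + iσ` of the line `Im = σ`. -/
noncomputable def lineAt (σ ξ : ℝ) : ℂ := (ξ : ℂ) + σ * Complex.I

@[simp] theorem lineAt_im (σ ξ : ℝ) : (lineAt σ ξ).im = σ := by simp [lineAt]

@[simp] theorem lineAt_re (σ ξ : ℝ) : (lineAt σ ξ).re = ξ := by simp [lineAt]

@[fun_prop] theorem continuous_lineAt (σ : ℝ) : Continuous (lineAt σ) := by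
  unfold lineAt
  fun_prop

theorem le_norm_lineAt (σ ξ : ℝ) : σ ≤ ‖lineAt σ ξ‖ := by
  simpa using Complex.im_le_norm (lineAt σ ξ)

/-- The frequency `2πν + iσ`; the integration variable `ν` is that of Mathlib's Fourier
transform. -/
noncomputable abbrev freq (σ ν : ℝ) : ℂ := lineAt σ (2 * Real.pi * ν)

/-- The function `ν ↦ ∫ e^{-iwt} φ(t) dt` with `w = 2πν + iσ`, against which the Fourier-Laplace
transform of a distribution is integrated to recover its value at `φ`. -/
noncomputable def lap (σ : ℝ) (φ : TestFn) : 𝓢(ℝ, ℂ) := 𝓕 (toSchwartz (expMul (-σ) φ))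

theorem lap_apply (σ : ℝ) (φ : TestFn) (ν : ℝ) :
    lap σ φ ν = ∫ t : ℝ, Complex.exp (-Complex.I * freq σ ν * t) * φ t := by
  rw [lap, SchwartzMap.fourier_coe, Real.fourier_real_eq_integral_exp_smul]
  refine integral_congr_ae (Filter.Eventually.of_forall fun t => ?_)
  have h : toSchwartz (expMul (-σ) φ) t = Complex.exp (σ * t) * φ t := by
    change ((Real.exp (-(-σ) * t) * φ t : ℝ) : ℂ) = _
    push_cast
    rw [neg_neg]
  simp only [h]
  rw [smul_eq_mul, ← mul_assoc, ← Complex.exp_add]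
  congr 2
  simp only [freq, lineAt]
  push_cast
  linear_combination ((σ : ℂ) * t) * (Complex.I_sq)

/-- The translate `t ↦ φ(t - s)` of a test function. -/
noncomputable def shift (s : ℝ) (φ : TestFn) : TestFn where
  toFun t := φ (t - s)
  contDiff' := φ.contDiff.comp (contDiff_id.sub contDiff_const)
  hasCompactSupport' := φ.hasCompactSupport.comp_homeomorph (Homeomorph.subRight s)
  tsupport_subset' := fun _ _ => trivial

@[simp] theorem shift_apply (s : ℝ) (φ : TestFn) (t : ℝ) : shift s φ t = φ (t - s) := rfl

@[simp] theorem shift_zero (φ : TestFn) : shift 0 φ = φ := by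
  ext t
  simp

theorem tsupport_shift (s : ℝ) (φ : TestFn) : tsupport (shift s φ) = (· - s) ⁻¹' tsupport φ :=
  tsupport_comp_eq_preimage φ (Homeomorph.subRight s)

theorem lap_shift (σ s : ℝ) (φ : TestFn) (ν : ℝ) :
    lap σ (shift s φ) ν = Complex.exp (-Complex.I * freq σ ν * s) * lap σ φ ν := by
  rw [lap_apply, lap_apply, ← integral_const_mul,
    ← integral_add_right_eq_self (fun t : ℝ =>
      Complex.exp (-Complex.I * freq σ ν * t) * (shift s φ t : ℂ)) s]
  refine integral_congr_ae (Filter.Eventually.of_forall fun t => ?_)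
  simp only [shift_apply, add_sub_cancel_right]
  rw [← mul_assoc, ← Complex.exp_add]
  congr 2
  push_cast
  ring

/-- The derivative of a test function. -/
noncomputable abbrev tderiv (φ : TestFn) : TestFn := ∂_{(1 : ℝ)} φ

theorem tderiv_apply (φ : TestFn) (t : ℝ) : tderiv φ t = deriv φ t := by
  have hd : DifferentiableAt ℝ φ t := φ.contDiff.differentiable (by simp) t
  have h : tderiv φ t = lineDeriv ℝ φ t 1 := by
    rw [tderiv, TestFunction.lineDerivOp_eq_lineDerivCLM ℝ]
    exact TestFunction.lineDerivCLM_apply_of_le (by simp)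
  rw [h, hd.lineDeriv_eq_fderiv, fderiv_apply_one_eq_deriv]

theorem hasDerivAt_test (φ : TestFn) (t : ℝ) : HasDerivAt φ (tderiv φ t) t := by
  rw [tderiv_apply]
  exact (φ.contDiff.differentiable (by simp) t).hasDerivAt

theorem tderiv_shift (s : ℝ) (φ : TestFn) : tderiv (shift s φ) = shift s (tderiv φ) := by
  ext t
  have h : HasDerivAt (shift s φ) (tderiv φ (t - s)) t :=
    (hasDerivAt_test φ (t - s)).comp_sub_const t s
  rw [tderiv_apply, h.deriv, shift_apply]

theorem tsupport_tderiv_subset (φ : TestFn) : tsupport (tderiv φ) ⊆ tsupport φ := by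
  have : (tderiv φ : ℝ → ℝ) = deriv φ := funext (tderiv_apply φ)
  rw [this]
  exact tsupport_deriv_subset

theorem lap_tderiv (σ : ℝ) (φ : TestFn) (ν : ℝ) :
    lap σ (tderiv φ) ν = Complex.I * freq σ ν * lap σ φ ν := by
  rw [lap_apply, lap_apply]
  set a : ℂ := -Complex.I * freq σ ν
  have hu : ∀ t : ℝ, HasDerivAt (fun t : ℝ => Complex.exp (a * t)) (a * Complex.exp (a * t)) t :=
    fun t => by
    have h := ((hasDerivAt_id (t : ℂ)).const_mul a).cexp.comp_ofReal
    simpa [mul_comm] using h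
  have hv : ∀ t : ℝ, HasDerivAt (fun t : ℝ => (φ t : ℂ)) (tderiv φ t : ℂ) t := fun t =>
    (hasDerivAt_test φ t).ofReal_comp
  have hint : ∀ (ψ : TestFn) (c : ℝ → ℂ), Continuous c → Integrable fun t => c t * (ψ t : ℂ) :=
    fun ψ c hc => by
    refine (hc.mul (Complex.continuous_ofReal.comp ψ.continuous)).integrable_of_hasCompactSupport ?_
    exact (ψ.hasCompactSupport.comp_left (g := fun r : ℝ => (r : ℂ)) Complex.ofReal_zero).mul_left
  have h := integral_mul_deriv_eq_deriv_mul_of_integrable (fun t _ => hu t) (fun t _ => hv t)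
    (hint (tderiv φ) _ (by fun_prop)) (hint φ _ (by fun_prop)) (hint φ _ (by fun_prop))
  rw [h, ← integral_const_mul, ← integral_neg]
  refine integral_congr_ae (Filter.Eventually.of_forall fun t => ?_)
  simp only [a]
  ring

theorem dt_apply {X : Type*} [NormedAddCommGroup X] [NormedSpace ℂ X]
    (f : 𝓓'((⊤ : Opens ℝ), X)) (φ : TestFn) : dt f φ = -f (tderiv φ) := by
  rw [dt, Distribution.lineDerivOp_apply_apply, map_neg]

/-- Every frequency is seen by some test function: a narrow bump at `0` has a nonzero transform. -/
theorem exists_lap_ne_zero (σ : ℝ) {N : ℝ} (hN : 0 < N) :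
    ∃ χ : TestFn, ∀ ν, |ν| < N → lap σ χ ν ≠ 0 := by
  have hr : 0 < 1 / (8 * N) := by positivity
  let b : ContDiffBump (0 : ℝ) := ⟨1 / (8 * N), 1 / (4 * N), hr,
    one_div_lt_one_div_of_lt (by positivity) (by linarith)⟩
  let χ : TestFn := ⟨b, b.contDiff, b.hasCompactSupport, fun _ _ => trivial⟩
  refine ⟨χ, fun ν hν h0 => ?_⟩
  have hχ : ∀ t, χ t = b t := fun t => rfl
  have hre : (lap σ χ ν).re =
      ∫ t : ℝ, Real.exp (σ * t) * Real.cos (2 * Real.pi * ν * t) * b t := by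
    have hi : Integrable fun t : ℝ => Complex.exp (-Complex.I * freq σ ν * t) * (χ t : ℂ) := by
      refine Continuous.integrable_of_hasCompactSupport ?_ ?_
      · exact (by fun_prop : Continuous fun t : ℝ => Complex.exp (-Complex.I * freq σ ν * t)).mul
          (Complex.continuous_ofReal.comp χ.continuous)
      · exact (χ.hasCompactSupport.comp_left (g := fun r : ℝ => (r : ℂ))
          Complex.ofReal_zero).mul_left
    rw [lap_apply]
    refine (integral_re hi).symm.trans (integral_congr_ae (Filter.Eventually.of_forall fun t => ?_))
    have e : RCLike.re (Complex.exp (-Complex.I * freq σ ν * t) * (χ t : ℂ)) =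
        (Complex.exp (-Complex.I * freq σ ν * t)).re * χ t := by
      simp
    simp only
    rw [e, Complex.exp_re, hχ]
    simp [Real.cos_neg]
  have hpos : 0 < ∫ t : ℝ, Real.exp (σ * t) * Real.cos (2 * Real.pi * ν * t) * b t := by
    refine Continuous.integral_pos_of_hasCompactSupport_nonneg_nonzero (x := 0) ?_ ?_ ?_ ?_
    · have := b.continuous
      fun_prop
    · exact b.hasCompactSupport.mul_left
    · intro t
      by_cases ht : |t| < 1 / (4 * N)
      · have h1 : |2 * Real.pi * ν * t| ≤ Real.pi / 2 := by
          rw [abs_mul, abs_mul, abs_of_pos Real.two_pi_pos]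
          have h2 : |ν| * |t| ≤ N * (1 / (4 * N)) :=
            mul_le_mul hν.le ht.le (abs_nonneg t) hN.le
          have h3 : N * (1 / (4 * N)) = 1 / 4 := by field_simp
          rw [h3] at h2
          nlinarith [Real.pi_pos]
        have h4 := Real.cos_nonneg_of_neg_pi_div_two_le_of_le (abs_le.1 h1).1 (abs_le.1 h1).2
        exact mul_nonneg (mul_nonneg (Real.exp_pos _).le h4) b.nonneg
      · have : b t = 0 := b.zero_of_le_dist (by simpa [Real.dist_eq, b] using ht)
        simp [this]
    · have : b 0 = 1 := b.one_of_mem_closedBall (by simp [b.rIn_pos.le])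
      simp [this]
  rw [← hre, h0] at hpos
  simp at hpos

/-! ### Distributions with a Fourier-Laplace transform -/

section Transform

variable {X : Type*} [NormedAddCommGroup X] [NormedSpace ℂ X]

/-- `f φ = ∫ (∫ e^{-iwt} φ(t) dt) q(ν) dν` with `w = 2πν + iσ`, for all test functions `φ`: the
function `q`, of at most polynomial growth in the mean, is the Fourier-Laplace transform of `f`. -/
structure HasTransform (σ : ℝ) (f : TestFn → X) (q : ℝ → X) : Prop where
  aesm : AEStronglyMeasurable q
  integrable : ∀ Φ : 𝓢(ℝ, ℂ), Integrable fun ν => Φ ν • q ν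
  eq : ∀ φ, f φ = ∫ ν, lap σ φ ν • q ν

/-- A smooth bump function on the line, as a Schwartz function. -/
noncomputable def bumpS (b : ContDiffBump (0 : ℝ)) : 𝓢(ℝ, ℂ) :=
  HasCompactSupport.toSchwartzMap (f := fun t => (b t : ℂ))
    (b.hasCompactSupport.comp_left (g := fun r : ℝ => (r : ℂ)) Complex.ofReal_zero)
    (Complex.ofRealCLM.contDiff.comp b.contDiff)

theorem aestronglyMeasurable_of_integrable_schwartz_smul {q : ℝ → X}
    (h : ∀ Φ : 𝓢(ℝ, ℂ), Integrable fun ν => Φ ν • q ν) : AEStronglyMeasurable q := by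
  let b : ℕ → ContDiffBump (0 : ℝ) := fun n => ⟨n + 1, n + 2, by positivity, by linarith⟩
  refine aestronglyMeasurable_of_tendsto_ae Filter.atTop
    (f := fun (n : ℕ) ν => bumpS (b n) ν • q ν) (fun n => (h _).aestronglyMeasurable) ?_
  refine Filter.Eventually.of_forall fun ν => tendsto_const_nhds.congr' ?_
  obtain ⟨N, hN⟩ := exists_nat_gt |ν|
  filter_upwards [Filter.eventually_ge_atTop N] with n hn
  have hn' : (N : ℝ) ≤ n := by exact_mod_cast hn
  have e : b n ν = 1 := (b n).one_of_mem_closedBall (by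
    have : (b n).rIn = n + 1 := rfl
    rw [mem_closedBall_zero_iff, Real.norm_eq_abs, this]
    linarith)
  have e2 : bumpS (b n) ν = (b n ν : ℂ) := rfl
  rw [e2, e, Complex.ofReal_one, one_smul]

theorem integrable_smul_of_temperate {q : ℝ → X}
    (h : ∀ Φ : 𝓢(ℝ, ℂ), Integrable fun ν => Φ ν • q ν) {g : ℝ → ℂ} (hg : g.HasTemperateGrowth)
    (Φ : 𝓢(ℝ, ℂ)) : Integrable fun ν => Φ ν • g ν • q ν := by
  refine (h (SchwartzMap.smulLeftCLM ℂ g Φ)).congr (Filter.Eventually.of_forall fun ν => ?_)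
  simp only [SchwartzMap.smulLeftCLM_apply_apply hg, smul_eq_mul, smul_smul]
  rw [mul_comm]

theorem hasTemperateGrowth_freq (σ : ℝ) : (freq σ).HasTemperateGrowth := by
  let L : ℝ →L[ℝ] ℂ := (2 * Real.pi) • Complex.ofRealCLM
  have h := L.hasTemperateGrowth.add (Function.HasTemperateGrowth.const ((σ : ℂ) * Complex.I))
  have e : freq σ = (L : ℝ → ℂ) + fun _ => (σ : ℂ) * Complex.I := by
    funext ν
    simp [freq, lineAt, L]
  rw [e]
  exact h

theorem HasLaplace.hasTransform {σ : ℝ} {f : 𝓓'((⊤ : Opens ℝ), X)} {F : ℝ → X}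
    (h : HasLaplace σ f F) : HasTransform σ f fun ν => F (2 * Real.pi * ν) := by
  obtain ⟨g, hg, H⟩ := h
  have hi := fun Φ => (H Φ).1
  refine ⟨aestronglyMeasurable_of_integrable_schwartz_smul hi, hi, fun φ => ?_⟩
  have e : expMul σ (expMul (-σ) φ) = φ := by
    ext t
    change Real.exp (-σ * t) * (Real.exp (-(-σ) * t) * φ t) = φ t
    rw [← mul_assoc, ← Real.exp_add]
    simp
  have h1 := hg (expMul (-σ) φ)
  rw [e] at h1
  rw [← h1, ← (H (lap σ φ)).2, lap, TemperedDistribution.fourierInv_apply,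
    FourierTransform.fourierInv_fourier_eq]

theorem HasTransform.sub {σ : ℝ} {f f' : TestFn → X} {q q' : ℝ → X} (h : HasTransform σ f q)
    (h' : HasTransform σ f' q') : HasTransform σ (fun φ => f φ - f' φ) fun ν => q ν - q' ν where
  aesm := h.aesm.sub h'.aesm
  integrable Φ := by
    simp only [smul_sub]
    exact (h.integrable Φ).sub (h'.integrable Φ)
  eq φ := by
    simp only [smul_sub]
    rw [integral_sub (h.integrable _) (h'.integrable _), h.eq, h'.eq]

theorem HasTransform.add {σ : ℝ} {f f' : TestFn → X} {q q' : ℝ → X} (h : HasTransform σ f q)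
    (h' : HasTransform σ f' q') : HasTransform σ (fun φ => f φ + f' φ) fun ν => q ν + q' ν where
  aesm := h.aesm.add h'.aesm
  integrable Φ := by
    simp only [smul_add]
    exact (h.integrable Φ).add (h'.integrable Φ)
  eq φ := by
    simp only [smul_add]
    rw [integral_add (h.integrable _) (h'.integrable _), h.eq, h'.eq]

theorem HasTransform.clm {Y : Type*} [NormedAddCommGroup Y] [NormedSpace ℂ Y] [CompleteSpace X]
    [CompleteSpace Y] {σ : ℝ} {f : TestFn → X} {q : ℝ → X} (h : HasTransform σ f q)
    (L : X →L[ℂ] Y) : HasTransform σ (fun φ => L (f φ)) fun ν => L (q ν) where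
  aesm := L.continuous.comp_aestronglyMeasurable h.aesm
  integrable Φ := by
    simp only [← map_smul]
    exact L.integrable_comp (h.integrable Φ)
  eq φ := by
    simp only [← map_smul]
    rw [h.eq, L.integral_comp_comm (h.integrable _)]

/-- Differentiation in time is multiplication by `-iw` of the transform. -/
theorem HasTransform.deriv {σ : ℝ} {f : TestFn → X} {q : ℝ → X} (h : HasTransform σ f q) :
    HasTransform σ (fun φ => -f (tderiv φ)) fun ν => (-Complex.I * freq σ ν) • q ν where
  aesm := by
    have : Continuous fun ν => -Complex.I * freq σ ν := by fun_prop
    exact this.aestronglyMeasurable.smul h.aesm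
  integrable Φ := integrable_smul_of_temperate h.integrable
    ((Function.HasTemperateGrowth.const _).mul (hasTemperateGrowth_freq σ)) Φ
  eq φ := by
    rw [h.eq, ← integral_neg]
    refine integral_congr_ae (Filter.Eventually.of_forall fun ν => ?_)
    simp only [lap_tderiv, smul_smul, ← neg_smul]
    congr 1
    ring

theorem HasTransform.dt {σ : ℝ} {f : 𝓓'((⊤ : Opens ℝ), X)} {q : ℝ → X} (h : HasTransform σ f q) :
    HasTransform σ (_root_.dt f) fun ν => (-Complex.I * freq σ ν) • q ν := by
  have e : (_root_.dt f : TestFn → X) = fun φ => -f (tderiv φ) := funext (dt_apply f)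
  rw [e]
  exact h.deriv

theorem norm_exp_freq (σ s ν : ℝ) :
    ‖Complex.exp (-Complex.I * freq σ ν * s)‖ = Real.exp (σ * s) := by
  rw [Complex.norm_exp]
  simp

/-- Injectivity of the Fourier transform on `L¹`. -/
theorem ae_eq_zero_of_fourier_eq_zero [CompleteSpace X] {g : ℝ → X} (hg : Integrable g)
    (h : ∀ s, 𝓕 g s = 0) : g =ᵐ[volume] 0 := by
  refine ae_eq_zero_of_integral_contDiff_smul_eq_zero hg.locallyIntegrable fun η hη hηs => ?_
  let Ψ : 𝓢(ℝ, ℂ) := HasCompactSupport.toSchwartzMap (f := fun t => (η t : ℂ))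
    (hηs.comp_left (g := fun r : ℝ => (r : ℂ)) Complex.ofReal_zero)
    (Complex.ofRealCLM.contDiff.comp hη)
  have e1 : ∀ t, (𝓕 (𝓕⁻ Ψ)) t = (η t : ℂ) := fun t => by
    rw [FourierTransform.fourier_fourierInv_eq]
    rfl
  have e2 := VectorFourier.integral_fourierIntegral_smul_eq_flip (L := innerₗ ℝ) (μ := volume)
    (ν := volume) Real.continuous_fourierChar continuous_inner ((𝓕⁻ Ψ).integrable (μ := volume)) hg
  calc ∫ t, η t • g t = ∫ t, (𝓕 (𝓕⁻ Ψ)) t • g t := by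
        refine integral_congr_ae (Filter.Eventually.of_forall fun t => ?_)
        simp only [e1]
        rw [Complex.coe_smul]
    _ = ∫ t, (𝓕⁻ Ψ) t • 𝓕 g t := by
        rw [SchwartzMap.fourier_coe]
        refine e2.trans (integral_congr_ae (Filter.Eventually.of_forall fun t => ?_))
        simp only [flip_innerₗ]
        rfl
    _ = 0 := by simp [h]

/-- The Fourier-Laplace transform is determined by the distribution. For a fixed test function
`χ` the Fourier transform of the integrable function `lap σ χ • q` is read off from the values at
the translates of `χ`. -/
theorem HasTransform.ae_eq_zero [CompleteSpace X] {σ : ℝ} {f : TestFn → X} {q : ℝ → X}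
    (h : HasTransform σ f q) (h0 : ∀ φ, f φ = 0) : q =ᵐ[volume] 0 := by
  have h1 : ∀ χ : TestFn, (fun ν => lap σ χ ν • q ν) =ᵐ[volume] 0 := fun χ => by
    refine ae_eq_zero_of_fourier_eq_zero (h.integrable _) fun s => ?_
    rw [Real.fourier_real_eq_integral_exp_smul]
    have h2 := h.eq (shift s χ)
    rw [h0] at h2
    have h3 : ∀ ν : ℝ, lap σ (shift s χ) ν • q ν = (Real.exp (σ * s) : ℂ) •
        Complex.exp (↑(-2 * Real.pi * ν * s) * Complex.I) • lap σ χ ν • q ν := fun ν => by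
      rw [lap_shift, smul_smul, smul_smul, Complex.ofReal_exp, ← Complex.exp_add]
      congr 3
      simp only [freq, lineAt]
      push_cast
      linear_combination (-(σ : ℂ) * s) * Complex.I_sq
    simp only [h3] at h2
    rw [integral_smul] at h2
    exact (smul_eq_zero.1 h2.symm).resolve_left (by exact_mod_cast (Real.exp_pos _).ne')
  choose χ hχ using fun n : ℕ => exists_lap_ne_zero σ (N := (n : ℝ) + 1) (by positivity)
  filter_upwards [ae_all_iff.2 fun n => h1 (χ n)] with ν hν
  obtain ⟨n, hn⟩ := exists_nat_gt |ν|
  exact (smul_eq_zero.1 (hν n)).resolve_left (hχ n ν (by linarith))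

theorem HasTransform.ae_eq [CompleteSpace X] {σ : ℝ} {f : TestFn → X} {q q' : ℝ → X}
    (h : HasTransform σ f q) (h' : HasTransform σ f q') : q =ᵐ[volume] q' := by
  filter_upwards [(h.sub h').ae_eq_zero fun φ => sub_self _] with ν hν
  exact sub_eq_zero.1 hν

/-- Translates of a test function are differentiated under the Laplace integral. -/
theorem HasTransform.hasDerivAt_shift {σ : ℝ} {f : TestFn → X} {q : ℝ → X}
    (h : HasTransform σ f q) (φ : TestFn) (s : ℝ) :
    HasDerivAt (fun s => f (shift s φ)) (-f (shift s (tderiv φ))) s := by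
  have hd : ∀ (ν r : ℝ), HasDerivAt (fun r => lap σ (shift r φ) ν • q ν)
      (-(lap σ (shift r (tderiv φ)) ν • q ν)) r := fun ν r => by
    simp only [lap_shift, lap_tderiv]
    set a : ℂ := -Complex.I * freq σ ν
    have h1 : HasDerivAt (fun t : ℝ => Complex.exp (a * t)) (Complex.exp (a * r) * a) r := by
      simpa using ((hasDerivAt_id (r : ℂ)).const_mul a).cexp.comp_ofReal
    have h2 := (h1.mul_const (lap σ φ ν)).smul_const (q ν)
    refine h2.congr_deriv ?_
    rw [← neg_smul]
    congr 1
    simp only [a]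
    ring
  have key := hasDerivAt_integral_of_dominated_loc_of_deriv_le (μ := volume) (x₀ := s)
    (s := Metric.ball s 1) (F := fun r ν => lap σ (shift r φ) ν • q ν)
    (F' := fun r ν => -(lap σ (shift r (tderiv φ)) ν • q ν))
    (bound := fun ν => Real.exp (|σ| * (|s| + 1)) * ‖lap σ (tderiv φ) ν • q ν‖)
    (Metric.ball_mem_nhds s one_pos)
    (Filter.Eventually.of_forall fun r => (h.integrable _).aestronglyMeasurable)
    (h.integrable _) (h.integrable _).aestronglyMeasurable.neg
    (Filter.Eventually.of_forall fun ν r hr => by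
      rw [lap_shift, norm_neg, mul_smul, norm_smul, norm_exp_freq]
      refine mul_le_mul_of_nonneg_right (Real.exp_le_exp.2 ?_) (norm_nonneg _)
      refine (le_abs_self _).trans ?_
      rw [abs_mul]
      refine mul_le_mul_of_nonneg_left ?_ (abs_nonneg σ)
      have h1 : |r - s| < 1 := by simpa [Real.dist_eq] using hr
      have h2 := abs_add_le (r - s) s
      rw [sub_add_cancel] at h2
      linarith)
    ((h.integrable _).norm.const_mul _)
    (Filter.Eventually.of_forall fun ν r _ => hd ν r)
  have e1 : (fun s => f (shift s φ)) = fun r => ∫ ν, lap σ (shift r φ) ν • q ν :=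
    funext fun r => h.eq _
  rw [e1, h.eq, ← integral_neg]
  exact key.2

/-- The values at translates towards `-∞` decay like `e^{σs}`. -/
theorem HasTransform.tendsto_shift {σ : ℝ} (hσ : 0 < σ) {f : TestFn → X} {q : ℝ → X}
    (h : HasTransform σ f q) (φ : TestFn) :
    Filter.Tendsto (fun s => f (shift s φ)) Filter.atBot (nhds 0) := by
  have hb : ∀ s, ‖f (shift s φ)‖ ≤ Real.exp (σ * s) * ∫ ν, ‖lap σ φ ν • q ν‖ := fun s => by
    rw [h.eq, ← integral_const_mul]
    refine (norm_integral_le_integral_norm _).trans (le_of_eq (integral_congr_ae ?_))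
    refine Filter.Eventually.of_forall fun ν => ?_
    simp only [lap_shift, mul_smul]
    rw [norm_smul, norm_exp_freq]
  refine squeeze_zero_norm hb ?_
  have h1 : Filter.Tendsto (fun s => Real.exp (σ * s)) Filter.atBot (nhds 0) :=
    Real.tendsto_exp_atBot.comp (Filter.tendsto_id.const_mul_atBot hσ)
  simpa using h1.mul_const (∫ ν, ‖lap σ φ ν • q ν‖)

end Transform

/-! ### Distributions with a given Fourier-Laplace transform -/

/-- Real functions that are smooth and supported in the compact set `K` embed continuously into
the complex Schwartz functions. -/
noncomputable def supportedToSchwartz (K : Compacts ℝ) : 𝓓_{K}(ℝ, ℝ) →L[ℝ] 𝓢(ℝ, ℂ) :=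
  let L : 𝓓_{K}(ℝ, ℝ) →ₗ[ℝ] 𝓢(ℝ, ℂ) :=
    { toFun := fun φ => HasCompactSupport.toSchwartzMap (f := fun t => (φ t : ℂ))
        (φ.hasCompactSupport.comp_left (g := fun r : ℝ => (r : ℂ)) Complex.ofReal_zero)
        (Complex.ofRealCLM.contDiff.comp φ.contDiff)
      map_add' := fun φ ψ => by
        ext t
        exact Complex.ofReal_add _ _
      map_smul' := fun c φ => by
        ext t
        exact Complex.ofReal_mul _ _ }
  { toLinearMap := L
    cont := by
      obtain ⟨R, hR⟩ := K.isCompact.isBounded.exists_norm_le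
      refine WithSeminorms.continuous_of_isBounded (ContDiffMapSupportedIn.withSeminorms ℝ ℝ ℝ ⊤ K)
        (schwartz_withSeminorms ℝ ℝ ℂ) L (.of_real fun kn => ⟨{kn.2}, |R| ^ kn.1, fun φ => ?_⟩)
      refine SchwartzMap.seminorm_le_bound ℝ kn.1 kn.2 (L φ) (by positivity) fun x => ?_
      have e : ‖iteratedFDeriv ℝ kn.2 (L φ) x‖ = ‖iteratedFDeriv ℝ kn.2 φ x‖ :=
        Complex.ofRealLI.norm_iteratedFDeriv_comp_left φ.contDiff.contDiffAt
          (by exact_mod_cast le_top)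
      rw [e]
      by_cases hx : x ∈ K
      · refine mul_le_mul (pow_le_pow_left₀ (norm_nonneg x) ((hR x hx).trans (le_abs_self R)) _)
          ?_ (norm_nonneg _) (by positivity)
        rw [Finset.sup_singleton]
        exact ContDiffMapSupportedIn.norm_iteratedFDeriv_apply_le_seminorm_top ℝ
      · rw [φ.iteratedFDeriv_zero_on_compl hx]
        simp only [Pi.zero_apply, norm_zero, mul_zero]
        positivity }

/-- The continuous map `φ ↦ e^{σt} φ` from test functions to Schwartz functions. -/
noncomputable def expSchwartz (σ : ℝ) : TestFn →L[ℝ] 𝓢(ℝ, ℂ) :=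
  have hexp : ContDiff ℝ ((⊤ : ℕ∞) : WithTop ℕ∞) fun t : ℝ => Real.exp (-(-σ) * t) :=
    Real.contDiff_exp.comp (contDiff_const.mul contDiff_id)
  TestFunction.limitCLM ℝ (fun φ => toSchwartz (expMul (-σ) φ))
    (fun K _ => (supportedToSchwartz K).comp
      (ContDiffMapSupportedIn.bilinLeftCLM (ContinuousLinearMap.mul ℝ ℝ) hexp))
    fun K hK φ => by
      ext t
      change ((Real.exp (-(-σ) * t) * φ t : ℝ) : ℂ) = ((φ t * Real.exp (-(-σ) * t) : ℝ) : ℂ)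
      rw [mul_comm]

theorem quasiMeasurePreserving_mul_left {a : ℝ} (ha : a ≠ 0) :
    Measure.QuasiMeasurePreserving (fun x : ℝ => a * x) volume volume := by
  refine ⟨measurable_const_mul a, ?_⟩
  rw [Real.map_volume_mul_left ha]
  exact Measure.smul_absolutelyContinuous

theorem ae_of_ae_two_pi_mul {P : ℝ → Prop} (h : ∀ᵐ ν : ℝ, P (2 * Real.pi * ν)) : ∀ᵐ ξ : ℝ, P ξ := by
  have h1 := (quasiMeasurePreserving_mul_left (inv_ne_zero Real.two_pi_pos.ne')).ae h
  filter_upwards [h1] with ξ hξ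
  rwa [mul_inv_cancel_left₀ Real.two_pi_pos.ne'] at hξ

/-- The weight `|w|^r` on the line `Im w = σ`. -/
noncomputable def weight (σ r ν : ℝ) : ℂ := ((‖freq σ ν‖ ^ r : ℝ) : ℂ)

theorem hasTemperateGrowth_weight {σ : ℝ} (hσ : 0 < σ) (r : ℝ) :
    (weight σ r).HasTemperateGrowth := by
  have h1 := Function.hasTemperateGrowth_one_add_norm_sq_rpow ℝ (r / 2)
  let L : ℝ →L[ℝ] ℝ := (2 * Real.pi / σ) • ContinuousLinearMap.id ℝ ℝ
  have h2 := h1.comp L.hasTemperateGrowth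
  have h3 := Complex.ofRealCLM.hasTemperateGrowth.comp h2
  have h4 : weight σ r = fun ν => ((σ ^ r : ℝ) : ℂ) *
      ((Complex.ofRealCLM : ℝ → ℂ) ∘ ((fun x : ℝ => (1 + ‖x‖ ^ 2) ^ (r / 2)) ∘ L)) ν := by
    funext ν
    simp only [weight, Function.comp, Complex.ofRealCLM_apply]
    rw [← Complex.ofReal_mul]
    congr 1
    have e1 : ‖freq σ ν‖ = (σ ^ 2 * (1 + ‖L ν‖ ^ 2)) ^ (1 / 2 : ℝ) := by
      rw [← Real.sqrt_eq_rpow, Complex.norm_eq_sqrt_sq_add_sq]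
      congr 1
      simp only [freq, lineAt_re, lineAt_im, L, smul_apply, ContinuousLinearMap.id_apply,
        smul_eq_mul, Real.norm_eq_abs, sq_abs]
      field_simp
      ring
    have h0 : 0 ≤ 1 + ‖L ν‖ ^ 2 := by positivity
    rw [e1, Real.mul_rpow (by positivity) h0, Real.mul_rpow (by positivity) (by positivity),
      ← Real.rpow_mul h0, ← Real.sqrt_eq_rpow, Real.sqrt_sq hσ.le]
    congr 2
    ring
  rw [h4]
  exact (Function.HasTemperateGrowth.const _).mul h3

theorem weightedNorm_congr {X : Type*} [NormedAddCommGroup X] {σ m : ℝ} {F F' : ℝ → X} (h : F =ᵐ[volume] F') :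
    weightedNorm σ m F = weightedNorm σ m F' := by
  rw [weightedNorm, weightedNorm]
  congr 1
  refine lintegral_congr_ae ?_
  filter_upwards [h] with ξ hξ
  rw [hξ]

/-- A factor `C |w|` costs one power of the weight. -/
theorem weightedNorm_le_of_norm_le {X Y : Type*} [NormedAddCommGroup X] [NormedAddCommGroup Y]
    {σ : ℝ} (hσ : 0 < σ) {m : ℝ} {F : ℝ → X} {G : ℝ → Y} (C : ℝ≥0)
    (h : ∀ᵐ ξ : ℝ, ‖G ξ‖ ≤ C * ‖lineAt σ ξ‖ * ‖F ξ‖) :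
    weightedNorm σ (m - 1) G ≤ C * weightedNorm σ m F := by
  have h1 : (∫⁻ ξ : ℝ, ENNReal.ofReal (‖lineAt σ ξ‖ ^ (2 * (m - 1))) * ‖G ξ‖ₑ ^ 2) ≤
      (C : ℝ≥0∞) ^ (2 : ℝ) *
        ∫⁻ ξ : ℝ, ENNReal.ofReal (‖lineAt σ ξ‖ ^ (2 * m)) * ‖F ξ‖ₑ ^ 2 := by
    rw [← lintegral_const_mul' _ _ (by simp)]
    refine lintegral_mono_ae ?_
    filter_upwards [h] with ξ hξ
    have h0 : 0 < ‖lineAt σ ξ‖ := hσ.trans_le (le_norm_lineAt _ _)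
    have e1 : ∀ x : ℝ, 0 ≤ x → ENNReal.ofReal x ^ 2 = ENNReal.ofReal (x ^ 2) := fun x hx =>
      (ENNReal.ofReal_pow hx 2).symm
    have e2 : (C : ℝ≥0∞) ^ (2 : ℝ) = ENNReal.ofReal ((C : ℝ) ^ 2) := by
      rw [ENNReal.rpow_two, ← e1 _ C.coe_nonneg, ENNReal.ofReal_coe_nnreal]
    rw [← ofReal_norm, ← ofReal_norm, e1 _ (norm_nonneg _), e1 _ (norm_nonneg _),
      e2, ← ENNReal.ofReal_mul (by positivity), ← ENNReal.ofReal_mul (by positivity),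
      ← ENNReal.ofReal_mul (by positivity)]
    refine ENNReal.ofReal_le_ofReal ?_
    have e3 : ‖lineAt σ ξ‖ ^ (2 * m) = ‖lineAt σ ξ‖ ^ (2 * (m - 1)) * ‖lineAt σ ξ‖ ^ 2 := by
      rw [← Real.rpow_natCast ‖lineAt σ ξ‖ 2, ← Real.rpow_add h0]
      congr 1
      push_cast
      ring
    rw [e3]
    calc _ ≤ ‖lineAt σ ξ‖ ^ (2 * (m - 1)) * (C * ‖lineAt σ ξ‖ * ‖F ξ‖) ^ 2 := by gcongr
      _ = _ := by ring
  have h2 := ENNReal.rpow_le_rpow h1 (by norm_num : (0 : ℝ) ≤ 1 / 2)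
  rw [ENNReal.mul_rpow_of_nonneg _ _ (by norm_num), ← ENNReal.rpow_mul] at h2
  norm_num at h2
  rw [weightedNorm, weightedNorm]
  norm_num
  exact h2

section Existence

variable {X : Type*} [NormedAddCommGroup X] [NormedSpace ℂ X]

/-- The weighted norm is the `L²` norm of `|w|^m F`. The Fourier variable `ν` of Mathlib and the real
part `ξ = 2πν` of the frequency differ by a dilation. -/
theorem memLp_weight_smul {σ m : ℝ} {F : ℝ → X} (hF : AEStronglyMeasurable F)
    (hw : weightedNorm σ m F < ⊤) :
    MemLp (fun ν => weight σ m ν • F (2 * Real.pi * ν)) 2 := by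
  set G : ℝ → X := fun ξ => ((‖lineAt σ ξ‖ ^ m : ℝ) : ℂ) • F ξ
  have hGm : AEStronglyMeasurable G := by
    refine AEStronglyMeasurable.smul ?_ hF
    exact (Complex.measurable_ofReal.comp
      ((continuous_lineAt σ).norm.measurable.pow_const m)).aestronglyMeasurable
  have hG : MemLp G 2 := by
    refine ⟨hGm, ?_⟩
    rw [eLpNorm_lt_top_iff_lintegral_rpow_enorm_lt_top two_ne_zero ENNReal.ofNat_ne_top]
    rw [weightedNorm, ENNReal.rpow_lt_top_iff_of_pos (by norm_num)] at hw
    refine lt_of_le_of_lt (le_of_eq (lintegral_congr fun ξ => ?_)) hw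
    have h0 : 0 ≤ ‖lineAt σ ξ‖ := norm_nonneg _
    have e : ‖((‖lineAt σ ξ‖ ^ m : ℝ) : ℂ)‖ₑ = ENNReal.ofReal (‖lineAt σ ξ‖ ^ m) := by
      rw [← ofReal_norm, Complex.norm_real, Real.norm_of_nonneg (by positivity)]
    simp only [G, ENNReal.toReal_ofNat]
    rw [enorm_smul, e, ENNReal.mul_rpow_of_nonneg _ _ zero_le_two,
      ENNReal.ofReal_rpow_of_nonneg (by positivity) zero_le_two, ← Real.rpow_mul h0, mul_comm m 2,
      ENNReal.rpow_two]
    rfl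
  have hq : AEStronglyMeasurable fun ν => G (2 * Real.pi * ν) :=
    hGm.comp_quasiMeasurePreserving (quasiMeasurePreserving_mul_left Real.two_pi_pos.ne')
  have h1 := ((memLp_two_iff_integrable_sq_norm hGm).1 hG).comp_mul_left' Real.two_pi_pos.ne'
  exact (memLp_two_iff_integrable_sq_norm hq).2 h1

/-- Every measurable function with a finite weighted norm is the Fourier-Laplace transform of a
distribution. -/
theorem exists_hasLaplace [CompleteSpace X] {σ : ℝ} (hσ : 0 < σ) {m : ℝ} {F : ℝ → X}
    (hF : AEStronglyMeasurable F) (hw : weightedNorm σ m F < ⊤) :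
    ∃ f : 𝓓'((⊤ : Opens ℝ), X), HasLaplace σ f F := by
  have hq := memLp_weight_smul hF hw
  -- `F` is the multiple of an `L²` function by a function of temperate growth
  let G : 𝓢'(ℝ, X) := TemperedDistribution.smulLeftCLM X (weight σ (-m))
    (Lp.toTemperedDistribution (hq.toLp _))
  have hwt : ∀ ν, weight σ (-m) ν * weight σ m ν = 1 := fun ν => by
    have h0 : 0 < ‖freq σ ν‖ := hσ.trans_le (le_norm_lineAt _ _)
    rw [weight, weight, ← Complex.ofReal_mul, ← Real.rpow_add h0]
    simp
  have e : ∀ (Φ : 𝓢(ℝ, ℂ)) (ν : ℝ), SchwartzMap.smulLeftCLM ℂ (weight σ (-m)) Φ ν •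
      (weight σ m ν • F (2 * Real.pi * ν)) = Φ ν • F (2 * Real.pi * ν) := fun Φ ν => by
    rw [SchwartzMap.smulLeftCLM_apply_apply (hasTemperateGrowth_weight hσ _), smul_smul,
      smul_eq_mul, mul_right_comm, hwt, one_mul]
  have hint : ∀ Φ : 𝓢(ℝ, ℂ), Integrable fun ν => Φ ν • F (2 * Real.pi * ν) := fun Φ => by
    have h1 : MemLp ((SchwartzMap.smulLeftCLM ℂ (weight σ (-m)) Φ : 𝓢(ℝ, ℂ)) : ℝ → ℂ) 2 volume :=
      SchwartzMap.memLp _ 2 volume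
    have h2 := memLp_one_iff_integrable.1 (hq.smul h1 (r := 1))
    exact h2.congr (Filter.Eventually.of_forall (e Φ))
  have hG : ∀ Φ : 𝓢(ℝ, ℂ), G Φ = ∫ ν, Φ ν • F (2 * Real.pi * ν) := fun Φ => by
    have h1 : G Φ = Lp.toTemperedDistribution (hq.toLp _)
      (SchwartzMap.smulLeftCLM ℂ (weight σ (-m)) Φ) := rfl
    rw [h1, Lp.toTemperedDistribution_apply]
    refine integral_congr_ae ?_
    filter_upwards [hq.coeFn_toLp] with ν hν
    rw [hν, e]
  -- the distribution is `e^{σt}` times the Fourier transform of `G`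
  let f : 𝓓'((⊤ : Opens ℝ), X) :=
    { toFun := fun φ => (𝓕 G) (expSchwartz σ φ)
      map_add' := fun φ ψ => by rw [map_add, map_add]
      map_smul' := fun c φ => by
        rw [map_smul, ← Complex.coe_smul c (expSchwartz σ φ), map_smul, Complex.coe_smul]
        rfl
      cont := (𝓕 G).continuous.comp (expSchwartz σ).continuous }
  refine ⟨f, 𝓕 G, fun φ => ?_, fun Φ => ⟨hint Φ, ?_⟩⟩
  · have h1 : expMul (-σ) (expMul σ φ) = φ := by
      ext t
      change Real.exp (-(-σ) * t) * (Real.exp (-σ * t) * φ t) = φ t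
      rw [← mul_assoc, ← Real.exp_add]
      simp
    have h2 : f (expMul σ φ) = (𝓕 G) (toSchwartz (expMul (-σ) (expMul σ φ))) := rfl
    rw [h2, h1]
  · rw [FourierTransform.fourierInv_fourier_eq, hG]

theorem HasLaplace.ae_eq [CompleteSpace X] {σ : ℝ} {f : 𝓓'((⊤ : Opens ℝ), X)} {F F' : ℝ → X}
    (h : HasLaplace σ f F) (h' : HasLaplace σ f F') : F =ᵐ[volume] F' :=
  ae_of_ae_two_pi_mul (h.hasTransform.ae_eq h'.hasTransform)

theorem HasLaplace.normHsm_eq [CompleteSpace X] {σ m : ℝ} {f : 𝓓'((⊤ : Opens ℝ), X)} {F : ℝ → X}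
    (h : HasLaplace σ f F) : normHsm σ m f = weightedNorm σ m F :=
  le_antisymm (iInf₂_le F h) (le_iInf₂ fun _ h' => (weightedNorm_congr (h.ae_eq h')).le)

theorem HasLaplace.aestronglyMeasurable {σ : ℝ} {f : 𝓓'((⊤ : Opens ℝ), X)} {F : ℝ → X}
    (h : HasLaplace σ f F) : AEStronglyMeasurable F := by
  have h1 := h.hasTransform.aesm.comp_quasiMeasurePreserving
    (quasiMeasurePreserving_mul_left (inv_ne_zero Real.two_pi_pos.ne'))
  refine h1.congr (Filter.Eventually.of_forall fun ξ => ?_)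
  simp only [Function.comp]
  rw [mul_inv_cancel_left₀ Real.two_pi_pos.ne']

end Existence

/-! ### The incident field at almost every frequency -/

theorem IsIncident.inner_eq_zero {Ω : Opens R3} {ε₀ μ₀ : ℝ} {E : 𝓓'((⊤ : Opens ℝ), L2On Ω)}
    (hE : IsIncident Ω ε₀ μ₀ E) (φ : TestFn) {Θ : 𝓢(R3, C3)} (hΘ : HasCompactSupport Θ)
    (hΘΩ : tsupport Θ ⊆ Ω) :
    inner ℂ (toL2 (curlS (curlS Θ))) (ext0 Ω (E φ)) +
      (ε₀ * μ₀ : ℝ) * inner ℂ (toL2 Θ) (ext0 Ω (dt (dt E) φ)) = 0 := by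
  have h := hE.vacuum φ (conjTest Θ hΘ hΘΩ)
  rwa [setIntegral_dot3, setIntegral_dot3, integral_dot3_curl_curl, integral_dot3_coe,
    conjSchwartz_conjTest] at h

/-- At almost every frequency the transform of an incident field solves the time-harmonic vacuum
equation. The exceptional null set can be chosen independently of the test field because the
pairs of a test field and its double curl form a separable subset of `L² × L²`. -/
theorem IsIncident.ae_isVacuum {Ω : Opens R3} {ε₀ μ₀ σ : ℝ} {E : 𝓓'((⊤ : Opens ℝ), L2On Ω)}
    (hE : IsIncident Ω ε₀ μ₀ E) {q : ℝ → L2On Ω} (hq : HasTransform σ E q) :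
    ∀ᵐ ν : ℝ, IsVacuum Ω (ε₀ * μ₀ * freq σ ν ^ 2) (ext0 Ω (q ν)) := by
  let S := {Θ : 𝓢(R3, C3) // HasCompactSupport Θ ∧ tsupport Θ ⊆ Ω}
  have hS : ∀ Θ : S, ∀ᵐ ν : ℝ, inner ℂ (toL2 (curlS (curlS Θ.1))) (ext0 Ω (q ν)) =
      ε₀ * μ₀ * freq σ ν ^ 2 * inner ℂ (toL2 Θ.1) (ext0 Ω (q ν)) := fun Θ => by
    have h1 := hq.clm ((innerSL ℂ (toL2 (curlS (curlS Θ.1)))).comp (ext0 Ω))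
    have h2 := hq.dt.dt.clm (((ε₀ * μ₀ : ℝ) : ℂ) • (innerSL ℂ (toL2 Θ.1)).comp (ext0 Ω))
    have h3 := (h1.add h2).ae_eq_zero fun φ => by
      simpa using hE.inner_eq_zero φ Θ.2.1 Θ.2.2
    filter_upwards [h3] with ν hν
    simp only [ContinuousLinearMap.comp_apply, innerSL_apply_apply, smul_apply, map_smul,
      smul_eq_mul, Pi.zero_apply] at hν
    push_cast at hν
    linear_combination hν - (ε₀ * μ₀ * freq σ ν ^ 2 * inner ℂ (toL2 Θ.1) (ext0 Ω (q ν))) * Complex.I_sq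
  let j : S → L2R3 × L2R3 := fun Θ => (toL2 (curlS (curlS Θ.1)), toL2 Θ.1)
  have : Fact ((2 : ℝ≥0∞) ≠ ⊤) := ⟨ENNReal.ofNat_ne_top⟩
  have : Nonempty (Set.range j) := ⟨⟨j ⟨0, by
    simp [HasCompactSupport.zero], by simp⟩, Set.mem_range_self _⟩⟩
  have hsc : SecondCountableTopology L2R3 := Lp.SecondCountableTopology
  have hsc' : SecondCountableTopology (Set.range j) :=
    TopologicalSpace.Subtype.secondCountableTopology _
  obtain ⟨u, hu⟩ := exists_dense_seq (Set.range j)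
  choose Θ hΘ using fun n => (u n).2
  filter_upwards [ae_all_iff.2 fun n => hS (Θ n)] with ν hν Θ' h1 h2
  have hclosed : IsClosed {p : Set.range j | inner ℂ p.1.1 (ext0 Ω (q ν)) =
      ε₀ * μ₀ * freq σ ν ^ 2 * inner ℂ p.1.2 (ext0 Ω (q ν))} :=
    isClosed_eq (by fun_prop) (by fun_prop)
  exact hu.induction_on (p := fun p : Set.range j => inner ℂ p.1.1 (ext0 Ω (q ν)) =
      ε₀ * μ₀ * freq σ ν ^ 2 * inner ℂ p.1.2 (ext0 Ω (q ν)))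
    ⟨j ⟨Θ', h1, h2⟩, Set.mem_range_self _⟩ hclosed fun n => by
      rw [← hΘ n]
      exact hν n

/-! ### Conservation of energy -/

/-- A solution of the source free Maxwell system for negative times that vanishes at `-∞` is zero:
its energy `⟪ε u, u⟫ + μ₀ ‖h‖²` is conserved. -/
theorem IsMedium.eq_zero_of_maxwell {Ω : Opens R3} {ε₀ μ₀ : ℝ} (hμ₀ : 0 < μ₀) {ε : R3 → ℝ}
    (hε : IsMedium Ω ε₀ ε) {u h u' h' : ℝ → L2R3} (hu : ∀ s ≤ 0, HasDerivAt u (u' s) s)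
    (hh : ∀ s ≤ 0, HasDerivAt h (h' s) s)
    (h1 : ∀ s ≤ 0, IsCurl (h s) (mulL (scalarField ε) (u' s)))
    (h2 : ∀ s ≤ 0, IsCurl (u s) (-((μ₀ : ℂ) • h' s)))
    (hu0 : Filter.Tendsto u Filter.atBot (nhds 0))
    (hh0 : Filter.Tendsto h Filter.atBot (nhds 0)) : u 0 = 0 ∧ h 0 = 0 := by
  set M := mulL (scalarField ε)
  -- the energy; its derivative vanishes because the curl is symmetric
  let W : ℝ → ℂ := fun s => inner ℂ (u s) (M (u s)) + μ₀ * inner ℂ (h s) (h s)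
  have hW : ∀ s ≤ 0, HasDerivAt (fun s => (W s).re) 0 s := fun s hs => by
    have hMu : HasDerivAt (fun s => M (u s)) (M (u' s)) s :=
      (M.restrictScalars ℝ).hasFDerivAt.comp_hasDerivAt s (hu s hs)
    have e1 := ((hu s hs).inner ℂ hMu).add (((hh s hs).inner ℂ (hh s hs)).const_mul (μ₀ : ℂ))
    have e2 := Complex.reCLM.hasFDerivAt.comp_hasDerivAt s e1
    refine e2.congr_deriv ?_
    have e3 := (h1 s hs).inner_comm (h2 s hs)
    rw [inner_neg_right, inner_smul_right] at e3
    have e4 : inner ℂ (u' s) (M (u s)) = inner ℂ (M (u' s)) (u s) :=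
      (inner_mulL_scalarField hε.memLp _ _).symm
    have e5 : (inner ℂ (u s) (M (u' s))).re = (inner ℂ (M (u' s)) (u s)).re := by
      rw [← inner_conj_symm, Complex.conj_re]
    have e6 : (inner ℂ (h' s) (h s)).re = (inner ℂ (h s) (h' s)).re := by
      rw [← inner_conj_symm, Complex.conj_re]
    have e7 := congrArg Complex.re e3
    simp only [Complex.neg_re, Complex.re_ofReal_mul] at e7
    simp only [Complex.reCLM_apply, Complex.add_re, Complex.re_ofReal_mul]
    rw [e4, e5, e6, e7]
    ring
  have hconst : ∀ a ≤ 0, (W a).re = (W 0).re := fun a ha =>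
    (constant_of_has_deriv_right_zero (f := fun s => (W s).re) (a := a) (b := 0)
      (fun s hs => (hW s hs.2).continuousAt.continuousWithinAt)
      (fun s hs => (hW s hs.2.le).hasDerivWithinAt) 0 ⟨ha, le_rfl⟩).symm
  have hlim : Filter.Tendsto (fun s => (W s).re) Filter.atBot (nhds 0) := by
    have e1 : Filter.Tendsto W Filter.atBot
        (nhds (inner ℂ (0 : L2R3) (M 0) + μ₀ * inner ℂ (0 : L2R3) 0)) :=
      (hu0.inner ((M.continuous.tendsto 0).comp hu0)).add ((hh0.inner hh0).const_mul _)
    have e2 := (Complex.continuous_re.tendsto _).comp e1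
    simpa [Function.comp_def] using e2
  have hW0 : (W 0).re = 0 := by
    refine tendsto_nhds_unique ?_ hlim
    refine tendsto_const_nhds.congr' ?_
    filter_upwards [Filter.eventually_le_atBot 0] with a ha
    exact (hconst a ha).symm
  obtain ⟨a, ha, H⟩ := hε.exists_le_re_inner
  obtain ⟨r, hr, hr'⟩ := H (u 0)
  have e : (W 0).re = r + μ₀ * ‖h 0‖ ^ 2 := by
    simp only [W]
    rw [hr', inner_self_eq_norm_sq_to_K, Complex.add_re, Complex.re_ofReal_mul, Complex.ofReal_re]
    congr 2
    norm_cast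
  rw [hW0] at e
  have k1 : 0 ≤ a * ‖u 0‖ ^ 2 := by positivity
  have k2 : 0 ≤ μ₀ * ‖h 0‖ ^ 2 := by positivity
  have k3 : a * ‖u 0‖ ^ 2 = 0 := by linarith
  have k4 : μ₀ * ‖h 0‖ ^ 2 = 0 := by linarith
  constructor
  · simpa [ha.ne'] using k3
  · simpa [hμ₀.ne'] using k4

/-! ### The scattering system -/

section Scattering

variable {Ω : Opens R3} {ε₀ μ₀ σ m : ℝ} {ε : R3 → ℝ} {Ei : 𝓓'((⊤ : Opens ℝ), L2On Ω)}

/-- Ampère's law in terms of multiplication operators and extension by zero. -/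
theorem IsMedium.isWeakCurl_source_iff (hε : IsMedium Ω ε₀ ε) {h v : L2R3} {f : L2On Ω} :
    (IsWeakCurl ⊤ h fun x => (ε x : ℂ) • v x
      + (Ω : Set R3).indicator (fun y => ((ε y - ε₀ : ℝ) : ℂ) • f y) x) ↔
    IsCurl h (mulL (scalarField ε) v + mulL (scalarField fun x => ε x - ε₀) (ext0 Ω f)) := by
  rw [← isWeakCurl_iff, IsWeakCurl, IsWeakCurl]
  refine forall_congr' fun ψ => ?_
  have e : ∀ᵐ x : R3, (ε x : ℂ) • v x
      + (Ω : Set R3).indicator (fun y => ((ε y - ε₀ : ℝ) : ℂ) • f y) x =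
      (mulL (scalarField ε) v + mulL (scalarField fun x => ε x - ε₀) (ext0 Ω f) : L2R3) x := by
    filter_upwards [Lp.coeFn_add (mulL (scalarField ε) v)
        (mulL (scalarField fun x => ε x - ε₀) (ext0 Ω f)),
      mulL_scalarField_coeFn hε.memLp v, mulL_scalarField_coeFn hε.memLp_sub (ext0 Ω f),
      ext0_coeFn f] with x h1 h2 h3 h4
    rw [h1, Pi.add_apply, h2, h3, h4]
    by_cases hx : x ∈ (Ω : Set R3)
    · simp [hx]
    · simp [hx]
  have e' : ∫ x, dot3 ((ε x : ℂ) • v x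
      + (Ω : Set R3).indicator (fun y => ((ε y - ε₀ : ℝ) : ℂ) • f y) x) (ψ x) =
      ∫ x, dot3 ((mulL (scalarField ε) v +
        mulL (scalarField fun x => ε x - ε₀) (ext0 Ω f) : L2R3) x) (ψ x) := by
    refine integral_congr_ae ?_
    filter_upwards [e] with x hx
    rw [hx]
  rw [e']

theorem HasTransform.eq_zero {X : Type*} [NormedAddCommGroup X] [NormedSpace ℂ X]
    {f : TestFn → X} {q : ℝ → X} (h : HasTransform σ f q) (h0 : q =ᵐ[volume] 0) (φ : TestFn) :
    f φ = 0 := by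
  rw [h.eq]
  refine integral_eq_zero_of_ae ?_
  filter_upwards [h0] with ν hν
  simp [hν]

theorem tsupport_shift_subset {φ : TestFn} (hφ : tsupport φ ⊆ Set.Iio 0) {s : ℝ} (hs : s ≤ 0) :
    tsupport (shift s φ) ⊆ Set.Iio 0 := by
  rw [tsupport_shift]
  intro t ht
  have h : t - s < 0 := hφ ht
  simp only [Set.mem_Iio]
  linarith

/-- The scattered electric field in the frequency domain. -/
noncomputable def scatE (ε₀ μ₀ : ℝ) (ε : R3 → ℝ) (σ : ℝ) (F : ℝ → L2On Ω) (ξ : ℝ) : HCurl :=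
  solOp ε₀ μ₀ ε (lineAt σ ξ) (ext0 Ω (F ξ))

/-- The scattered magnetic field in the frequency domain, `(iwμ₀)⁻¹ ∇ × E`. -/
noncomputable def scatH (ε₀ μ₀ : ℝ) (ε : R3 → ℝ) (σ : ℝ) (F : ℝ → L2On Ω) (ξ : ℝ) : L2R3 :=
  (Complex.I * lineAt σ ξ * μ₀)⁻¹ • curlL (scatE ε₀ μ₀ ε σ F ξ)

theorem lineAt_ne_zero (hσ : 0 < σ) (ξ : ℝ) : lineAt σ ξ ≠ 0 :=
  norm_pos_iff.1 (hσ.trans_le (le_norm_lineAt σ ξ))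

theorem aestronglyMeasurable_clm_apply {X Y : Type*} [NormedAddCommGroup X] [NormedSpace ℂ X]
    [NormedAddCommGroup Y] [NormedSpace ℂ Y] {T : ℝ → X →L[ℂ] Y} (hT : Continuous T) {g : ℝ → X}
    (hg : AEStronglyMeasurable g) : AEStronglyMeasurable fun ξ => T ξ (g ξ) := by
  have h : Continuous fun p : ℝ × X => T p.1 p.2 :=
    (hT.comp continuous_fst).clm_apply continuous_snd
  exact h.comp_aestronglyMeasurable (aestronglyMeasurable_id.prodMk hg)

theorem aestronglyMeasurable_scatE (hμ₀ : 0 < μ₀) (hε : IsMedium Ω ε₀ ε) (hσ : 0 < σ)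
    {F : ℝ → L2On Ω} (hF : AEStronglyMeasurable F) :
    AEStronglyMeasurable (scatE ε₀ μ₀ ε σ F) := by
  have h1 : Continuous fun ξ => solOp ε₀ μ₀ ε (lineAt σ ξ) :=
    continuous_iff_continuousAt.2 fun ξ =>
      (continuousAt_solOp hμ₀ hε (by simpa using hσ)).comp (continuous_lineAt σ).continuousAt
  exact aestronglyMeasurable_clm_apply h1 ((ext0 Ω).continuous.comp_aestronglyMeasurable hF)

theorem aestronglyMeasurable_scatH (hμ₀ : 0 < μ₀) (hε : IsMedium Ω ε₀ ε) (hσ : 0 < σ)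
    {F : ℝ → L2On Ω} (hF : AEStronglyMeasurable F) :
    AEStronglyMeasurable (scatH ε₀ μ₀ ε σ F) := by
  have h1 : Continuous fun ξ => (Complex.I * lineAt σ ξ * μ₀)⁻¹ :=
    Continuous.inv₀ (by fun_prop) fun ξ => by simp [lineAt_ne_zero hσ, hμ₀.ne']
  have h2 : AEStronglyMeasurable fun ξ => curlL (scatE ε₀ μ₀ ε σ F ξ) :=
    curlL.continuous.comp_aestronglyMeasurable (aestronglyMeasurable_scatE hμ₀ hε hσ hF)
  exact h1.aestronglyMeasurable.smul h2

theorem norm_curlL_le (u : HCurl) : ‖curlL u‖ ≤ ‖u‖ := by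
  refine abs_le_of_sq_le_sq' ?_ (norm_nonneg u) |>.2
  rw [norm_sq_HCurl]
  nlinarith [sq_nonneg ‖fieldL u‖]

theorem weightedNorm_scatH_lt_top (hμ₀ : 0 < μ₀) (hσ : 0 < σ) {F : ℝ → L2On Ω}
    (h : weightedNorm σ m (scatE ε₀ μ₀ ε σ F) < ⊤) :
    weightedNorm σ (m - 1) (scatH ε₀ μ₀ ε σ F) < ⊤ := by
  let C : ℝ≥0 := ⟨(σ ^ 2 * μ₀)⁻¹, by positivity⟩
  refine (weightedNorm_le_of_norm_le hσ C (Filter.Eventually.of_forall fun ξ => ?_)).trans_lt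
    (ENNReal.mul_lt_top ENNReal.coe_lt_top h)
  have h1 := le_norm_lineAt σ ξ
  have h0 : 0 < ‖lineAt σ ξ‖ := hσ.trans_le h1
  rw [scatH, norm_smul, norm_inv, norm_mul, norm_mul, Complex.norm_I, one_mul, Complex.norm_real,
    Real.norm_of_nonneg hμ₀.le]
  refine mul_le_mul ?_ (norm_curlL_le _) (norm_nonneg _) (by positivity)
  change (‖lineAt σ ξ‖ * μ₀)⁻¹ ≤ (σ ^ 2 * μ₀)⁻¹ * ‖lineAt σ ξ‖
  rw [inv_mul_eq_div, le_div_iff₀ (by positivity), inv_mul_le_iff₀ (by positivity)]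
  have : σ ^ 2 ≤ ‖lineAt σ ξ‖ * ‖lineAt σ ξ‖ := by nlinarith
  nlinarith

/-- The distributions with transforms `scatE` and `scatH` solve the scattering system. Causality
follows from the conservation of energy, as they vanish at `-∞` and have no source for negative
times. -/
theorem isScattered_of_hasLaplace (hμ₀ : 0 < μ₀) (hε : IsMedium Ω ε₀ ε) (hσ : 0 < σ)
    (hEi : IsCausal Ei) {F : ℝ → L2On Ω} (hF : HasLaplace σ Ei F)
    {Es : 𝓓'((⊤ : Opens ℝ), HCurl)} (hEs : HasLaplace σ Es (scatE ε₀ μ₀ ε σ F))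
    {Hs : 𝓓'((⊤ : Opens ℝ), L2R3)} (hHs : HasLaplace σ Hs (scatH ε₀ μ₀ ε σ F)) :
    IsScattered Ω ε₀ μ₀ ε Ei Es Hs := by
  have tE := hEs.hasTransform
  have tH := hHs.hasTransform
  have tI := hF.hasTransform
  have hμ' : (μ₀ : ℂ) ≠ 0 := by exact_mod_cast hμ₀.ne'
  have faraday : ∀ φ : TestFn, HCurl.curl (Es φ) + (μ₀ : ℂ) • dt Hs φ = 0 := fun φ => by
    have h := ((tE.clm curlL).add (tH.dt.clm ((μ₀ : ℂ) • ContinuousLinearMap.id ℂ L2R3))).eq_zero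
      (Filter.Eventually.of_forall fun ν => by
        have hw := lineAt_ne_zero hσ (2 * Real.pi * ν)
        simp only [scatH, smul_apply, ContinuousLinearMap.id_apply, smul_smul, Pi.zero_apply]
        have e : (μ₀ : ℂ) * (-Complex.I * freq σ ν *
            (Complex.I * lineAt σ (2 * Real.pi * ν) * μ₀)⁻¹) = -1 := by
          field_simp
        rw [e, neg_one_smul, add_neg_cancel]) φ
    exact h
  have ampere : ∀ φ : TestFn, IsCurl (Hs φ) (mulL (scalarField ε) (fieldL (dt Es φ)) +
      mulL (scalarField fun x => ε x - ε₀) (ext0 Ω (dt Ei φ))) := fun φ Ψ => by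
    set M := mulL (scalarField ε)
    set Q := mulL (scalarField fun x => ε x - ε₀)
    have h := ((tH.clm (innerSL ℂ (toL2 (curlS Ψ)))).sub
      ((tE.dt.clm ((innerSL ℂ (toL2 Ψ)).comp (M.comp fieldL))).add
        (tI.dt.clm ((innerSL ℂ (toL2 Ψ)).comp (Q.comp (ext0 Ω)))))).eq_zero
      (Filter.Eventually.of_forall fun ν => by
        have hw := lineAt_ne_zero hσ (2 * Real.pi * ν)
        have hc := isCurl_curlL_solOp hμ₀ hε (w := freq σ ν) (by simpa using hσ)
          (ext0 Ω (F (2 * Real.pi * ν))) Ψ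
        simp only [scatH, scatE, ContinuousLinearMap.comp_apply, innerSL_apply_apply, map_smul,
          inner_smul_right, Pi.zero_apply, smul_eq_mul] at hc ⊢
        rw [hc, inner_add_right]
        simp only [freq]
        field_simp
        linear_combination (lineAt σ (2 * Real.pi * ν) *
          (inner ℂ (toL2 Ψ) (M (fieldL (solOp ε₀ μ₀ ε (lineAt σ (2 * Real.pi * ν))
            (ext0 Ω (F (2 * Real.pi * ν)))))) +
          inner ℂ (toL2 Ψ) (Q (ext0 Ω (F (2 * Real.pi * ν)))))) * Complex.I_sq) φ
    rw [inner_add_right]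
    exact sub_eq_zero.1 h
  -- negative times are reached by translating a test function supported there to the left
  have hzero : ∀ φ : TestFn, tsupport φ ⊆ Set.Iio 0 → Es φ = 0 ∧ Hs φ = 0 := fun φ hφ => by
    have hsrc : ∀ s ≤ 0, dt Ei (shift s φ) = 0 := fun s hs => by
      refine (dt_apply Ei (shift s φ)).trans ?_
      rw [hEi _ ((tsupport_tderiv_subset _).trans (tsupport_shift_subset hφ hs)), neg_zero]
    have h := hε.eq_zero_of_maxwell hμ₀ (u := fun s => fieldL (Es (shift s φ)))
      (h := fun s => Hs (shift s φ)) (u' := fun s => fieldL (dt Es (shift s φ)))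
      (h' := fun s => dt Hs (shift s φ))
      (fun s _ => by
        refine ((tE.clm fieldL).hasDerivAt_shift φ s).congr_deriv ?_
        have e : dt Es (shift s φ) = -Es (tderiv (shift s φ)) := dt_apply Es _
        rw [e, map_neg, tderiv_shift]
        rfl)
      (fun s _ => by
        refine (tH.hasDerivAt_shift φ s).congr_deriv ?_
        have e : dt Hs (shift s φ) = -Hs (tderiv (shift s φ)) := dt_apply Hs _
        rw [e, tderiv_shift]
        rfl)
      (fun s hs => by
        have := ampere (shift s φ)
        rwa [hsrc s hs, map_zero, map_zero, add_zero] at this)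
      (fun s _ => by
        have := isCurl_fieldL (Es (shift s φ))
        rwa [curlL_apply, eq_neg_of_add_eq_zero_left (faraday (shift s φ))] at this)
      ((tE.clm fieldL).tendsto_shift hσ φ) (tH.tendsto_shift hσ φ)
    simp only [shift_zero] at h
    exact ⟨HCurl.ext_field (h.1.trans (map_zero _).symm), h.2⟩
  exact ⟨fun φ hφ => (hzero φ hφ).1, fun φ hφ => (hzero φ hφ).2, faraday,
    fun φ => hε.isWeakCurl_source_iff.2 (ampere φ)⟩

/-- The difference of a test function and its translate is a derivative. -/
theorem exists_tderiv_eq_sub_shift (φ : TestFn) (s : ℝ) : ∃ η : TestFn, tderiv η = φ - shift s φ := by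
  let G : ℝ → ℝ := fun t => ∫ r in (0 : ℝ)..t, φ r
  have hG : ∀ t, HasDerivAt G (φ t) t := fun t => φ.continuous.integral_hasStrictDerivAt 0 t |>.hasDerivAt
  have hGc : ContDiff ℝ ∞ G := contDiff_infty_iff_deriv.2
    ⟨fun t => (hG t).differentiableAt, by
      have : deriv G = φ := funext fun t => (hG t).deriv
      rw [this]
      exact φ.contDiff⟩
  obtain ⟨R, hR⟩ := φ.hasCompactSupport.isCompact.isBounded.exists_norm_le
  have hφ : ∀ r, R < |r| → φ r = 0 := fun r hr => by
    by_contra h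
    exact absurd (hR r (subset_tsupport _ h)) (not_le.2 hr)
  have hη : ∀ t, G t - G (t - s) = ∫ r in (t - s)..t, φ r := fun t =>
    intervalIntegral.integral_interval_sub_left (φ.continuous.intervalIntegrable _ _)
      (φ.continuous.intervalIntegrable _ _)
  -- a difference of two values of the primitive `G`, hence compactly supported
  let η : TestFn :=
    { toFun := fun t => G t - G (t - s)
      contDiff' := hGc.sub (hGc.comp (contDiff_id.sub contDiff_const))
      hasCompactSupport' := by
        refine HasCompactSupport.of_support_subset_isCompact
          (isCompact_Icc (a := -(R + |s|)) (b := R + |s|)) fun t ht => ?_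
        by_contra hmem
        refine ht ?_
        have hlt : R + |s| < |t| := by
          by_contra hle
          exact hmem (abs_le.1 (not_lt.1 hle))
        simp only [hη]
        refine intervalIntegral.integral_zero_ae (Filter.Eventually.of_forall fun r hr => hφ r ?_)
        -- `r` lies between `t - s` and `t`
        have h1 : |r - t| ≤ |s| := by
          have h2 := Set.abs_sub_right_of_mem_uIcc (Set.uIoc_subset_uIcc hr)
          rw [abs_sub_comm] at h2
          simpa using h2
        have h3 := abs_sub_abs_le_abs_sub t r
        rw [abs_sub_comm] at h3
        linarith
      tsupport_subset' := fun _ _ => trivial }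
  refine ⟨η, ?_⟩
  ext t
  have h : HasDerivAt η (φ t - φ (t - s)) t := (hG t).sub ((hG (t - s)).comp_sub_const t s)
  rw [tderiv_apply, h.deriv]
  rfl

/-- The scattering system has at most one solution whose electric field has a Fourier-Laplace
transform. No growth is assumed on the magnetic field, so that the energy argument is applied to
the time derivatives of the difference of two solutions: by Faraday's law, that of the magnetic
field is a multiple of the curl of the electric field. -/
theorem IsScattered.unique (hμ₀ : 0 < μ₀) (hε : IsMedium Ω ε₀ ε) (hσ : 0 < σ)
    {E E' : 𝓓'((⊤ : Opens ℝ), HCurl)} {H H' : 𝓓'((⊤ : Opens ℝ), L2R3)}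
    (h : IsScattered Ω ε₀ μ₀ ε Ei E H) (h' : IsScattered Ω ε₀ μ₀ ε Ei E' H')
    {G G' : ℝ → HCurl} (hG : HasLaplace σ E G) (hG' : HasLaplace σ E' G') : E' = E ∧ H' = H := by
  set e : TestFn → HCurl := fun φ => E' φ - E φ with he
  set k : TestFn → L2R3 := fun φ => H' φ - H φ with hk
  have hμ' : (μ₀ : ℂ) ≠ 0 := by exact_mod_cast hμ₀.ne'
  have te : HasTransform σ e _ := hG'.hasTransform.sub hG.hasTransform
  have faraday : ∀ φ, k (tderiv φ) = (μ₀ : ℂ)⁻¹ • curlL (e φ) := fun φ => by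
    have h1 := h.faraday φ
    have h2 := h'.faraday φ
    have d1 : dt H φ = -H (tderiv φ) := dt_apply H φ
    have d2 : dt H' φ = -H' (tderiv φ) := dt_apply H' φ
    rw [d1, smul_neg, ← sub_eq_add_neg, sub_eq_zero, ← curlL_apply] at h1
    rw [d2, smul_neg, ← sub_eq_add_neg, sub_eq_zero, ← curlL_apply] at h2
    simp only [he, hk]
    rw [map_sub, h1, h2, ← smul_sub, smul_smul, inv_mul_cancel₀ hμ', one_smul]
  have ampere : ∀ φ, IsCurl (k φ) (mulL (scalarField ε) (-fieldL (e (tderiv φ)))) := fun φ => by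
    have h1 := hε.isWeakCurl_source_iff.1 (h.ampere φ)
    have h2 := hε.isWeakCurl_source_iff.1 (h'.ampere φ)
    have h3 := h2.sub h1
    have d1 : dt E φ = -E (tderiv φ) := dt_apply E φ
    have d2 : dt E' φ = -E' (tderiv φ) := dt_apply E' φ
    rw [add_sub_add_right_eq_sub, ← map_sub, ← fieldL_apply, ← fieldL_apply, ← map_sub, d1, d2,
      neg_sub_neg] at h3
    have e3 : -fieldL (e (tderiv φ)) = fieldL (E (tderiv φ) - E' (tderiv φ)) := by
      rw [← map_neg]
      exact congrArg fieldL (neg_sub _ _)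
    rw [e3]
    exact h3
  -- the energy of the time derivative of the difference vanishes
  have hed : ∀ φ, e (tderiv φ) = 0 := fun φ => by
    have hz := hε.eq_zero_of_maxwell hμ₀ (u := fun s => fieldL (e (shift s (tderiv φ))))
      (h := fun s => (μ₀ : ℂ)⁻¹ • curlL (e (shift s φ)))
      (u' := fun s => -fieldL (e (shift s (tderiv (tderiv φ)))))
      (h' := fun s => (μ₀ : ℂ)⁻¹ • -curlL (e (shift s (tderiv φ))))
      (fun s _ => (te.clm fieldL).hasDerivAt_shift (tderiv φ) s)
      (fun s _ => ((te.clm curlL).hasDerivAt_shift φ s).fun_const_smul _)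
      (fun s _ => by
        have := ampere (shift s (tderiv φ))
        rwa [tderiv_shift, ← tderiv_shift s φ, faraday] at this)
      (fun s _ => by
        rw [smul_smul, mul_inv_cancel₀ hμ', one_smul, neg_neg]
        exact isCurl_fieldL _)
      ((te.clm fieldL).tendsto_shift hσ _)
      (by simpa using ((te.clm curlL).tendsto_shift hσ φ).const_smul (μ₀ : ℂ)⁻¹)
    simp only [shift_zero] at hz
    exact HCurl.ext_field (hz.1.trans (map_zero _).symm)
  -- `s ↦ e (shift s φ)` is constant and decays at `-∞`
  have he0 : ∀ φ, e φ = 0 := fun φ => by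
    have hd : ∀ s, HasDerivAt (fun s => e (shift s φ)) 0 s := fun s => by
      have := te.hasDerivAt_shift φ s
      rwa [← tderiv_shift, hed, neg_zero] at this
    have hc : ∀ s, e (shift s φ) = e φ := fun s => by
      have := is_const_of_deriv_eq_zero (fun s => (hd s).differentiableAt)
        (fun s => (hd s).deriv) s 0
      simpa using this
    have := te.tendsto_shift hσ φ
    simp only [hc] at this
    exact tendsto_nhds_unique tendsto_const_nhds this
  -- `k` has vanishing time derivative, hence is invariant under translations, and is causal
  have hk0 : ∀ φ, k φ = 0 := fun φ => by
    obtain ⟨R, hR⟩ := φ.hasCompactSupport.isCompact.isBounded.exists_norm_le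
    have hs : tsupport (shift (-(|R| + 1)) φ) ⊆ Set.Iio 0 := by
      rw [tsupport_shift]
      intro t ht
      have h1 : t - -(|R| + 1) ≤ R := (le_abs_self _).trans (hR _ ht)
      have h2 := le_abs_self R
      simp only [Set.mem_Iio]
      linarith
    obtain ⟨η, hη⟩ := exists_tderiv_eq_sub_shift φ (-(|R| + 1))
    have h1 : k (tderiv η) = k φ - k (shift (-(|R| + 1)) φ) := by
      simp only [hk]
      rw [hη, map_sub, map_sub]
      abel
    have h2 : k (shift (-(|R| + 1)) φ) = 0 :=
      (congrArg₂ (· - ·) (h'.causal_H _ hs) (h.causal_H _ hs)).trans (sub_zero 0)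
    rw [faraday, he0, map_zero, smul_zero, h2, sub_zero] at h1
    exact h1.symm
  exact ⟨DFunLike.ext _ _ fun φ => sub_eq_zero.1 (he0 φ),
    DFunLike.ext _ _ fun φ => sub_eq_zero.1 (hk0 φ)⟩

end Scattering

theorem mainTheorem3 (Ω : Opens R3) (ε₀ μ₀ : ℝ) (hε₀ : 0 < ε₀) (hμ₀ : 0 < μ₀)
    (ε : R3 → ℝ) (hε : IsMedium Ω ε₀ ε) (σ : ℝ) (hσ : 0 < σ) (m : ℝ) :
    ∃ C : ℝ≥0, 0 < C ∧
      ∀ Ei : 𝓓'((⊤ : Opens ℝ), L2On Ω), IsIncident Ω ε₀ μ₀ Ei → MemHsm σ m Ei →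
        ∃ (Es : 𝓓'((⊤ : Opens ℝ), HCurl)) (Hs : 𝓓'((⊤ : Opens ℝ), L2R3)),
          MemHsm σ (m - 1) Es ∧ IsScattered Ω ε₀ μ₀ ε Ei Es Hs ∧
          normHsm σ (m - 1) Es ≤ C * normHsm σ m Ei ∧
          ∀ (Es' : 𝓓'((⊤ : Opens ℝ), HCurl)) (Hs' : 𝓓'((⊤ : Opens ℝ), L2R3)),
            MemHsm σ (m - 1) Es' → IsScattered Ω ε₀ μ₀ ε Ei Es' Hs' → Es' = Es ∧ Hs' = Hs := by
  obtain ⟨C, hC, hbound⟩ := exists_norm_solOp_le hε₀ hμ₀ hε hσ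
  lift C to ℝ≥0 using hC.le
  refine ⟨C, by exact_mod_cast hC, fun Ei hEi ⟨F, hF, hFw⟩ => ?_⟩
  have hvac : ∀ᵐ ξ : ℝ, IsVacuum Ω (ε₀ * μ₀ * lineAt σ ξ ^ 2) (ext0 Ω (F ξ)) :=
    ae_of_ae_two_pi_mul (hEi.ae_isVacuum hF.hasTransform)
  have hEw : weightedNorm σ (m - 1) (scatE ε₀ μ₀ ε σ F) ≤
      (C : ℝ≥0∞) * weightedNorm σ m F := by
    refine weightedNorm_le_of_norm_le hσ _ ?_
    filter_upwards [hvac] with ξ hξ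
    have := hbound (lineAt σ ξ) (lineAt_im σ ξ) _ hξ
    rwa [norm_ext0] at this
  have hEt : weightedNorm σ (m - 1) (scatE ε₀ μ₀ ε σ F) < ⊤ :=
    hEw.trans_lt (ENNReal.mul_lt_top ENNReal.coe_lt_top hFw)
  obtain ⟨Es, hEs⟩ := exists_hasLaplace hσ
    (aestronglyMeasurable_scatE hμ₀ hε hσ hF.aestronglyMeasurable) hEt
  obtain ⟨Hs, hHs⟩ := exists_hasLaplace hσ
    (aestronglyMeasurable_scatH hμ₀ hε hσ hF.aestronglyMeasurable)
    (weightedNorm_scatH_lt_top hμ₀ hσ hEt)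
  have hs := isScattered_of_hasLaplace hμ₀ hε hσ hEi.causal hF hEs hHs
  refine ⟨Es, Hs, ⟨_, hEs, hEt⟩, hs, ?_, fun Es' Hs' ⟨G, hG, _⟩ hs' => ?_⟩
  · rw [hEs.normHsm_eq, hF.normHsm_eq]
    exact hEw
  · exact hs.unique hμ₀ hε hσ hs' hEs hG
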